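/- **Setting.** A single-antenna source sends to a single-antenna destination through an amplify-and-forward relay with $N\ge 1$ antennas, which is disturbed by $M\ge 1$ interferers. Let $h_1\in\mathbb C^{N\times 1}$ (source–relay), $h_{Ii}\in\mathbb C^{N\times 1}$, $i=1,\dots,M$ (interferer–relay) and $h_2\in\mathbb C^{1\times N}$ (relay–destination) be random channel vectors all of whose entries are independent $\mathcal{CN}(0,1)$ random variables. Let $P_s,P_r,P_{I1},\dots,P_{IM},N_0>0$ be the source, relay, interference and noise powers (the $P_{Ii}$ need not be distinct), and put $\rho_1=P_s/N_0$, $\rho_2=P_r/N_0$, $\rho_{Ii}=P_{Ii}/N_0$. For a relay precoder $W\in\mathbb C^{N\times N}$ the end-to-end SINR is $$\gamma=\frac{|h_2Wh_1|^2P_s}{\sum_{i=1}^M|h_2Wh_{Ii}|^2P_{Ii}+\|h_2W\|^2N_0+N_0},$$ and the MRC/MRT scheme uses $$W=\omega\,\frac{h_2^\dagger}{\|h_2\|}\,\frac{h_1^\dagger}{\|h_1\|},\qquad \omega^2=\frac{P_r}{\|h_1\|^2P_s+\frac{1}{\|h_1\|^2}\sum_{i=1}^M|h_1^\dagger h_{Ii}|^2P_{Ii}+N_0}.$$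 Let $D=\mathrm{diag}(\rho_{I1},\dots,\rho_{IM})$, let $\rho_{I\langle1\rangle}>\dots>\rho_{I\langle\rho(D)\rangle}$ be its distinct diagonal elements, with multiplicities $\tau_1(D),\dots,\tau_{\rho(D)}(D)$, and let the characteristic coefficients $\chi_{p,q}(D)$ be the coefficients of the partial fraction expansion $$\det(I+\xi D)^{-1}=\sum_{p=1}^{\rho(D)}\sum_{q=1}^{\tau_p(D)}\frac{\chi_{p,q}(D)}{(1+\xi\rho_{I\langle p\rangle})^{q}}\qquad(\xi\in\mathbb R,\ \det(I+\xi D)\ne0),$$ which exist and are unique. Let $K_\nu$ be the modified Bessel function of the second kind, $K_\nu(z)=\int_0^\infty e^{-z\cosh t}\cosh(\nu t)\,dt$ for $z>0$. **Theorem 1.** For every threshold $\gamma_{\rm th}>0$, the outage probability $P_{\rm out}^{\rm MRC}=\mathrm{Prob}(\gamma<\gamma_{\rm th})$ of the MRC/MRT scheme is $$P_{\rm out}^{\rm MRC}=1-\frac{2e^{-\frac{\gamma_{\rm th}}{\rho_1}-\frac{\gamma_{\rm th}}{\rho_2}}}{\Gamma(N)}\sum_{m=0}^{N-1}\Big(\frac{\gamma_{\rm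 th}}{\rho_1}\Big)^m\frac1{m!}\sum_{j=0}^m\binom mj\Big(\frac1{\rho_2}\Big)^{m-j}\sum_{k=0}^{N+j-1}\binom{N+j-1}{k}\Big(\frac{\gamma_{\rm th}}{\rho_2}\Big)^{N+j-1-k}\Big[\frac{(\gamma_{\rm th}+1)\gamma_{\rm th}}{\rho_1\rho_2}\Big]^{\frac{k-m+1}2}\mathcal I_{k,m}(\gamma_{\rm th}),$$ where, all integrals being convergent, $$\mathcal I_{k,m}(\gamma_{\rm th})=\sum_{p=1}^{\rho(D)}\sum_{q=1}^{\tau_p(D)}\chi_{p,q}(D)\frac{\rho_{I\langle p\rangle}^{-q}}{(q-1)!}\int_0^\infty K_{k-m+1}\!\left(2\sqrt{\tfrac{(\gamma_{\rm th}+1)\gamma_{\rm th}}{\rho_1\rho_2}(x+1)}\right)(x+1)^{\frac{k+m+1}2}x^{q-1}e^{-\left(\frac{\gamma_{\rm th}}{\rho_1}+\frac1{\rho_{I\langle p\rangle}}\right)x}\,dx.$$ -/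

import Mathlib

open MeasureTheory ProbabilityTheory Matrix
open scoped Nat

noncomputable section

namespace Relay

/-! ### Channels and signal model -/

/-- The law `CN(0,1)` of a circular complex Gaussian random variable with zero mean and unit
variance: independent real and imaginary parts, both real Gaussian with mean `0` and
variance `1/2`. -/
def stdComplexGaussian : Measure ℂ :=
  ((gaussianReal 0 (1 / 2)).prod (gaussianReal 0 (1 / 2))).map
    Complex.measurableEquivRealProd.symm

/-- The squared Frobenius (Euclidean) norm of a complex vector. -/
def sqNorm {N : ℕ} (v : Fin N → ℂ) : ℝ := ∑ i, ‖v i‖ ^ 2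

/-- All scalar channel coefficients, gathered in one family: the entries of the source-relay
channel `h₁`, those of the interferer-relay channels `h_{I,i}`, and those of the
relay-destination channel `h₂`. -/
def channelEntries {Ω : Type*} {N M : ℕ} (h₁ : Ω → Fin N → ℂ) (hI : Ω → Fin M → Fin N → ℂ)
    (h₂ : Ω → Fin N → ℂ) : Fin N ⊕ (Fin M × Fin N) ⊕ Fin N → Ω → ℂ
  | .inl n => fun ω => h₁ ω n
  | .inr (.inl (i, n)) => fun ω => hI ω i n
  | .inr (.inr n) => fun ω => h₂ ω n

/-- The end-to-end SINR of the dual-hop link with relay precoder `W`, source power `Ps`,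
interference powers `PI i` and noise power `N₀`:
`|h₂ W h₁|² Ps / (∑ i, |h₂ W h_{I,i}|² PI i + ‖h₂ W‖² N₀ + N₀)`. -/
def sinr {N M : ℕ} (Ps N₀ : ℝ) (PI : Fin M → ℝ) (h₁ : Fin N → ℂ) (hI : Fin M → Fin N → ℂ)
    (h₂ : Fin N → ℂ) (W : Matrix (Fin N) (Fin N) ℂ) : ℝ :=
  ‖h₂ ⬝ᵥ (W *ᵥ h₁)‖ ^ 2 * Ps /
    (∑ i, ‖h₂ ⬝ᵥ (W *ᵥ hI i)‖ ^ 2 * PI i + sqNorm (h₂ ᵥ* W) * N₀ + N₀)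

/-- The squared power-constraint factor `ω²` of the MRC/MRT relay with transmit power `Pr`:
`Pr / (h₁†h₁ Ps + (∑ i, |h₁† h_{I,i}|² PI i) / ‖h₁‖² + N₀)`. -/
def mrcGainSq {N M : ℕ} (Ps Pr N₀ : ℝ) (PI : Fin M → ℝ) (h₁ : Fin N → ℂ)
    (hI : Fin M → Fin N → ℂ) : ℝ :=
  Pr / (sqNorm h₁ * Ps + (∑ i, ‖star h₁ ⬝ᵥ hI i‖ ^ 2 * PI i) / sqNorm h₁ + N₀)

/-- The MRC/MRT relay precoder `W = ω (h₂† / ‖h₂‖) (h₁† / ‖h₁‖)`, a rank-one `N × N` matrix. -/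
def mrcPrecoder {N M : ℕ} (Ps Pr N₀ : ℝ) (PI : Fin M → ℝ) (h₁ : Fin N → ℂ)
    (hI : Fin M → Fin N → ℂ) (h₂ : Fin N → ℂ) : Matrix (Fin N) (Fin N) ℂ :=
  ((√(mrcGainSq Ps Pr N₀ PI h₁ hI) : ℝ) : ℂ) •
    vecMulVec (fun n => star (h₂ n) / ((√(sqNorm h₂) : ℝ) : ℂ))
      (fun n => star (h₁ n) / ((√(sqNorm h₁) : ℝ) : ℂ))

/-- The end-to-end SINR of the MRC/MRT scheme. -/
def sinrMRC {N M : ℕ} (Ps Pr N₀ : ℝ) (PI : Fin M → ℝ) (h₁ : Fin N → ℂ)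
    (hI : Fin M → Fin N → ℂ) (h₂ : Fin N → ℂ) : ℝ :=
  sinr Ps N₀ PI h₁ hI h₂ (mrcPrecoder Ps Pr N₀ PI h₁ hI h₂)

/-- The outage probability `Prob(γ < γth)`. -/
def outageProb {Ω : Type*} [MeasurableSpace Ω] (μ : Measure Ω) (γ : Ω → ℝ) (γth : ℝ) : ℝ :=
  μ.real {ω | γ ω < γth}

/-! ### Distinct powers, multiplicities and characteristic coefficients -/

/-- The number of distinct diagonal elements of `diag(a)`. -/
def numDistinct {M : ℕ} (a : Fin M → ℝ) : ℕ := (Finset.univ.image a).card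

/-- The distinct diagonal elements of `diag(a)` in decreasing order; index `p` (from `0`) is the
`(p+1)`-st largest one. -/
def distinctVal {M : ℕ} (a : Fin M → ℝ) (p : Fin (numDistinct a)) : ℝ :=
  (Finset.univ.image a).orderEmbOfFin rfl p.rev

/-- The multiplicity of the `(p+1)`-st largest distinct diagonal element of `diag(a)`. -/
def multiplicity {M : ℕ} (a : Fin M → ℝ) (p : Fin (numDistinct a)) : ℕ :=
  (Finset.univ.filter fun i => a i = distinctVal a p).card

/-- `χ` is a family of coefficients of the partial fraction expansion
`det(I + ξ D)⁻¹ = ∑ p, ∑ q, χ_{p,q} / (1 + ξ a_{⟨p⟩}) ^ q`, `D = diag(a)`, where `ξ` is any scalar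
for which `I + ξ D` is nonsingular and `q` runs from `1` to the multiplicity of `a_{⟨p⟩}`.
The index `q : Fin _` starts at `0` and stands for the index `q + 1` of the formula. -/
def IsCharCoeff {M : ℕ} (a : Fin M → ℝ)
    (χ : (p : Fin (numDistinct a)) → Fin (multiplicity a p) → ℝ) : Prop :=
  ∀ ξ : ℝ, (1 + ξ • diagonal a).det ≠ 0 →
    ((1 + ξ • diagonal a).det)⁻¹ =
      ∑ p, ∑ q : Fin (multiplicity a p), χ p q / (1 + ξ * distinctVal a p) ^ (q.val + 1)

open Classical in
/-- The characteristic coefficients of `diag(a)`: the coefficients of the partial fraction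
expansion of `det(I + ξ diag(a))⁻¹` (which are unique for nonzero entries). -/
def charCoeff {M : ℕ} (a : Fin M → ℝ) :
    (p : Fin (numDistinct a)) → Fin (multiplicity a p) → ℝ :=
  if h : ∃ χ, IsCharCoeff a χ then h.choose else fun _ _ => 0

/-! ### The Bessel function and the integral -/

/-- The modified Bessel function of the second kind `K_ν(z)`, for real order `ν` and `z > 0`:
`K_ν(z) = ∫_0^∞ exp(-z cosh t) cosh(ν t) dt`. -/
def besselK (ν z : ℝ) : ℝ :=
  ∫ t in Set.Ioi (0 : ℝ), Real.exp (-z * Real.cosh t) * Real.cosh (ν * t)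

/-- The integrand
`K_{k-m+1}(2 √((γ+1)γ/(ρ₁ρ₂) (x+1))) (x+1)^{(k+m+1)/2} x^{q-1} e^{-(γ/ρ₁ + 1/r) x}`,
with `q - 1` written as `q`. -/
def outageIntegrand (ρ₁ ρ₂ γ r : ℝ) (k m q : ℕ) (x : ℝ) : ℝ :=
  besselK ((k : ℝ) - m + 1) (2 * √((γ + 1) * γ / (ρ₁ * ρ₂) * (x + 1))) *
    (x + 1) ^ (((k : ℝ) + m + 1) / 2) * x ^ q * Real.exp (-(γ / ρ₁ + 1 / r) * x)

/-- The integral `𝓘(γ)` belonging to the summation indices `k` and `m`, for the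
interference-to-noise ratios `ρI`. -/
def outageIntegral {M : ℕ} (ρ₁ ρ₂ : ℝ) (ρI : Fin M → ℝ) (γ : ℝ) (k m : ℕ) : ℝ :=
  ∑ p, ∑ q : Fin (multiplicity ρI p),
    charCoeff ρI p q * ((distinctVal ρI p ^ (q.val + 1))⁻¹ / (q.val)!) *
      ∫ x in Set.Ioi (0 : ℝ), outageIntegrand ρ₁ ρ₂ γ (distinctVal ρI p) k m q.val x

end Relay

end

/-!
For one realisation of the channels the SINR depends only on three scalars: the gains
`α = ‖h₁‖²` and `x = ‖h₂‖²`, and the interference power `u = ∑ i, |h₁† h_{I,i}|² ρ_{I,i} / ‖h₁‖²`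
left after receive combining (`sinrMRC_eq`). The link succeeds exactly when `x` exceeds
`τ = γ / ρ₂` and `α` exceeds `(γ / ρ₁) (u + 1) (x + 1 / ρ₂) / (x - τ)` (`erlang_slice`).

The three scalars are independent. Given `h₁ ≠ 0`, the projections of the interferer channels on
`h₁ / ‖h₁‖` are again independent standard complex Gaussian variables, whatever `h₁` is, so the law
of `u` does not depend on `h₁` (`map_combinedInterference`, `measurePreserving_gains`). The gains
have Erlang laws (`map_sqNorm`). The Laplace transform of `u` is `det(I + ξ D)⁻¹`; expanding it in
partial fractions (`existsUnique_isCharCoeff`) and inverting term by term gives the density of `u`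
as a mixture of Gamma densities weighted by the characteristic coefficients
(`integral_interferenceLaw`). Those coefficients may be negative; uniqueness of Laplace transforms
is therefore proved for signed densities (`integral_eq_of_laplace`), with Stone-Weierstrass for
polynomials in `exp (-x)` as the underlying fact.

For fixed `u`, the tail of `α` is a Poisson sum (`erlang_Ici`). Averaging it over `x = s + τ` and
expanding the powers of `s + τ + 1 / ρ₂` and of `s + τ` by the binomial theorem leaves integrals
`∫ s ^ (ν - 1) exp (-s - β / s) ds` with `ν = k - m + 1` and `β` proportional to `u + 1`
(`lintegral_erlang_tail`). These equal `2 β ^ (ν / 2) K_ν(2 √β)` (`integral_besselKernel`), and the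
average over `u` is the integral of the formula (`integral_condTerm`).
-/

noncomputable section

namespace Relay

/-! ### Partial fractions -/

section PartialFractions

open Polynomial

variable {M : ℕ} {a : Fin M → ℝ}

lemma distinctVal_mem (a : Fin M → ℝ) (p : Fin (numDistinct a)) :
    ∃ i, a i = distinctVal a p := by
  have := Finset.orderEmbOfFin_mem (Finset.univ.image a) rfl p.rev
  simpa [distinctVal] using this

lemma distinctVal_pos (ha : ∀ i, 0 < a i) (p : Fin (numDistinct a)) : 0 < distinctVal a p := by
  obtain ⟨i, hi⟩ := distinctVal_mem a p
  exact hi ▸ ha i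

lemma distinctVal_injective (a : Fin M → ℝ) : Function.Injective (distinctVal a) := fun _ _ h =>
  Fin.rev_injective (((Finset.univ.image a).orderEmbOfFin rfl).injective h)

lemma image_distinctVal (a : Fin M → ℝ) :
    Finset.univ.image (distinctVal a) = Finset.univ.image a := by
  refine Finset.eq_of_subset_of_card_le (fun x hx => ?_) ?_
  · obtain ⟨p, -, rfl⟩ := Finset.mem_image.1 hx
    exact Finset.orderEmbOfFin_mem _ _ _
  · rw [Finset.card_image_of_injective _ (distinctVal_injective a)]
    exact (Finset.card_fin _).ge

lemma multiplicity_pos (a : Fin M → ℝ) (p : Fin (numDistinct a)) : 0 < multiplicity a p := by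
  obtain ⟨i, hi⟩ := distinctVal_mem a p
  exact Finset.card_pos.2 ⟨i, by simp [hi]⟩

/-- A product over the diagonal entries groups into the distinct values. -/
lemma prod_eq_prod_distinctVal (a : Fin M → ℝ) (f : ℝ → ℝ) :
    ∏ i, f (a i) = ∏ p, f (distinctVal a p) ^ multiplicity a p := by
  rw [Finset.prod_comp f a, ← image_distinctVal,
    Finset.prod_image fun x _ y _ h => distinctVal_injective a h]
  rfl

lemma det_one_add_smul_diagonal (a : Fin M → ℝ) (ξ : ℝ) :
    (1 + ξ • diagonal a).det = ∏ p, (1 + ξ * distinctVal a p) ^ multiplicity a p := by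
  rw [← prod_eq_prod_distinctVal a (fun x => 1 + ξ * x), ← diagonal_one, ← diagonal_smul,
    diagonal_add, det_diagonal]
  simp

/-- The monic linear factor attached to the `p`-th distinct value `d`, namely `ξ + 1 / d`. -/
def linFactor (a : Fin M → ℝ) (p : Fin (numDistinct a)) : ℝ[X] := X + C (distinctVal a p)⁻¹

lemma one_add_mul_distinctVal (ha : ∀ i, 0 < a i) (p : Fin (numDistinct a)) (ξ : ℝ) :
    1 + ξ * distinctVal a p = distinctVal a p * (linFactor a p).eval ξ := by
  have := (distinctVal_pos ha p).ne'
  simp [linFactor]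
  field_simp
  ring

lemma monic_linFactor (a : Fin M → ℝ) (p : Fin (numDistinct a)) : (linFactor a p).Monic :=
  monic_X_add_C _

lemma degree_linFactor (a : Fin M → ℝ) (p : Fin (numDistinct a)) : (linFactor a p).degree = 1 :=
  degree_X_add_C _

lemma isCoprime_linFactor (a : Fin M → ℝ) :
    Set.Pairwise (Finset.univ : Finset (Fin (numDistinct a))) fun i j =>
      IsCoprime (linFactor a i) (linFactor a j) := by
  intro i _ j _ hij
  have h : -(distinctVal a i)⁻¹ ≠ -(distinctVal a j)⁻¹ := by
    simpa using fun h => hij (distinctVal_injective a h)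
  have := isCoprime_X_sub_C_of_isUnit_sub (sub_ne_zero.2 h).isUnit
  simpa [linFactor] using this

lemma eval_linFactor_pos (ha : ∀ i, 0 < a i) {ξ : ℝ} (hξ : 0 ≤ ξ) (p : Fin (numDistinct a)) :
    0 < (linFactor a p).eval ξ := by
  have := distinctVal_pos ha p
  simp only [linFactor, eval_add, eval_X, eval_C]
  positivity

/-- The partial fraction expansion after clearing denominators, evaluated at one point. The
remainder multiplying the `j`-th power of the factor belongs to the pole order `τ - j`. -/
lemma expansion_iff_eval (ha : ∀ i, 0 < a i)
    (χ : (p : Fin (numDistinct a)) → Fin (multiplicity a p) → ℝ) (ξ : ℝ)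
    (hξ : ∀ p, (linFactor a p).eval ξ ≠ 0) :
    ((1 + ξ • diagonal a).det)⁻¹ =
      ∑ p, ∑ q : Fin (multiplicity a p), χ p q / (1 + ξ * distinctVal a p) ^ (q.val + 1) ↔
    (∏ p, (distinctVal a p) ^ multiplicity a p)⁻¹ =
      ∑ p, ∑ j : Fin (multiplicity a p),
        χ p j.rev / distinctVal a p ^ (j.rev.val + 1) * (linFactor a p).eval ξ ^ j.val *
          ∏ k ∈ Finset.univ.erase p, (linFactor a k).eval ξ ^ multiplicity a k := by
  have hG : ∏ p, (linFactor a p).eval ξ ^ multiplicity a p ≠ 0 :=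
    Finset.prod_ne_zero_iff.2 fun p _ => pow_ne_zero _ (hξ p)
  rw [det_one_add_smul_diagonal]
  simp_rw [one_add_mul_distinctVal ha, mul_pow, Finset.prod_mul_distrib]
  rw [mul_inv, ← div_eq_mul_inv, div_eq_iff hG, Finset.sum_mul]
  refine Eq.congr rfl (Finset.sum_congr rfl fun p _ => ?_)
  rw [Finset.sum_mul, ← Equiv.sum_comp Fin.revPerm]
  refine Finset.sum_congr rfl fun j _ => ?_
  rw [← Finset.mul_prod_erase _ _ (Finset.mem_univ p)]
  have hj : multiplicity a p = (j.rev.val + 1) + j.val := by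
    have := j.2
    rw [Fin.val_rev]; omega
  have h2 : (linFactor a p).eval ξ ^ multiplicity a p =
      (linFactor a p).eval ξ ^ (j.rev.val + 1) * (linFactor a p).eval ξ ^ j.val := by
    rw [← pow_add, ← hj]
  have h3 := pow_ne_zero (j.rev.val + 1) (hξ p)
  have h4 := pow_ne_zero (j.rev.val + 1) (distinctVal_pos ha p).ne'
  rw [h2, Fin.revPerm_apply]
  field_simp

/-- The remainder polynomials that correspond to a family of coefficients. -/
def remainder (χ : (p : Fin (numDistinct a)) → Fin (multiplicity a p) → ℝ)
    (p : Fin (numDistinct a)) (j : Fin (multiplicity a p)) : ℝ[X] :=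
  C (χ p j.rev / distinctVal a p ^ (j.rev.val + 1))

/-- Clearing denominators turns the expansion into an identity of polynomials. -/
lemma isCharCoeff_iff (ha : ∀ i, 0 < a i)
    (χ : (p : Fin (numDistinct a)) → Fin (multiplicity a p) → ℝ) :
    IsCharCoeff a χ ↔ C (∏ p, (distinctVal a p) ^ multiplicity a p)⁻¹ =
      ∑ p, ∑ j : Fin (multiplicity a p), remainder χ p j * linFactor a p ^ j.val *
          ∏ k ∈ Finset.univ.erase p, linFactor a k ^ multiplicity a k := by
  have key (ξ : ℝ) (hξ : ∀ p, (linFactor a p).eval ξ ≠ 0) :=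
    expansion_iff_eval ha χ ξ hξ
  constructor
  · intro h
    refine Polynomial.eq_of_infinite_eval_eq _ _ ((Set.Ici_infinite (0 : ℝ)).mono ?_)
    intro ξ hξ
    have hpos := fun p => (eval_linFactor_pos ha hξ p).ne'
    have := (key ξ hpos).1 (h ξ ?_)
    · simpa [eval_finsetSum, eval_prod, remainder] using this
    · rw [det_one_add_smul_diagonal, Finset.prod_ne_zero_iff]
      intro p _
      rw [one_add_mul_distinctVal ha]
      exact pow_ne_zero _ (mul_ne_zero (distinctVal_pos ha p).ne' (hpos p))
  · intro h ξ hξ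
    refine (key ξ fun p h0 => hξ ?_).2 ?_
    · rw [det_one_add_smul_diagonal]
      refine Finset.prod_eq_zero (Finset.mem_univ p) ?_
      rw [one_add_mul_distinctVal ha, h0, mul_zero, zero_pow]
      exact (multiplicity_pos a p).ne'
    · simpa [eval_finsetSum, eval_prod, remainder] using congrArg (Polynomial.eval ξ) h

/-- The characteristic coefficients exist and are unique. -/
lemma existsUnique_isCharCoeff (hM : 1 ≤ M) (ha : ∀ i, 0 < a i) : ∃! χ, IsCharCoeff a χ := by
  have hdeg (χ : (p : Fin (numDistinct a)) → Fin (multiplicity a p) → ℝ) :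
      ∀ p ∈ (Finset.univ : Finset (Fin (numDistinct a))), ∀ j,
        (remainder χ p j).degree < (linFactor a p).degree := fun p _ j => by
    rw [degree_linFactor]
    exact degree_C_le.trans_lt (by norm_num)
  obtain ⟨q, r, hr, hf⟩ := eq_quo_mul_prod_pow_add_sum_rem_mul_prod_pow
    (s := Finset.univ) (C (∏ p, (distinctVal a p) ^ multiplicity a p)⁻¹)
    (g := linFactor a) (fun p _ => monic_linFactor a p) (isCoprime_linFactor a) (multiplicity a)
  have hrC : ∀ p j, r p j = C ((r p j).coeff 0) := fun p j => by
    refine eq_C_of_degree_le_zero ?_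
    have := hr p (Finset.mem_univ p) j
    rw [degree_linFactor] at this
    exact Nat.WithBot.lt_one_iff_le_zero.1 this
  have hq : q = 0 := by
    by_contra hq
    have hP : (∏ p, linFactor a p ^ multiplicity a p).Monic :=
      monic_prod_of_monic _ _ fun p _ => (monic_linFactor a p).pow _
    have hmem : q * ∏ p, linFactor a p ^ multiplicity a p ∈
        degreeLT ℝ (∏ p, linFactor a p ^ multiplicity a p).natDegree := by
      rw [eq_sub_of_add_eq hf.symm]
      have hE (p) : (∏ k ∈ Finset.univ.erase p, linFactor a k ^ multiplicity a k).Monic :=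
        monic_prod_of_monic _ _ fun p _ => (monic_linFactor a p).pow _
      have hdegP (p) : (∏ p, linFactor a p ^ multiplicity a p).natDegree = multiplicity a p +
          (∏ k ∈ Finset.univ.erase p, linFactor a k ^ multiplicity a k).natDegree := by
        rw [← Finset.mul_prod_erase _ _ (Finset.mem_univ p),
          ((monic_linFactor a p).pow _).natDegree_mul (hE p), (monic_linFactor a p).natDegree_pow,
          linFactor, natDegree_X_add_C, mul_one]
      refine Submodule.sub_mem _ ?_ (Submodule.sum_mem _ fun p _ =>
        Submodule.sum_mem _ fun j _ => ?_)
      · obtain ⟨p, -⟩ : ∃ p, p ∈ (Finset.univ : Finset (Fin (numDistinct a))) := by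
          have h := Finset.mem_image_of_mem a (Finset.mem_univ ⟨0, hM⟩)
          rw [← image_distinctVal] at h
          exact (Finset.mem_image.1 h).imp fun _ h => h.1
        rw [mem_degreeLT]
        refine degree_C_le.trans_lt ?_
        rw [hdegP p]
        exact_mod_cast Nat.add_pos_left (multiplicity_pos a p) _
      · rw [hrC p j, mul_assoc, C_mul']
        refine Submodule.smul_mem _ _ (mem_degreeLT.2 (degree_le_natDegree.trans_lt ?_))
        rw [hdegP p]
        rw [((monic_linFactor a p).pow _).natDegree_mul (hE p), (monic_linFactor a p).natDegree_pow,
          linFactor, natDegree_X_add_C, mul_one]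
        exact_mod_cast Nat.add_lt_add_right j.2 _
    rw [mem_degreeLT, hP.degree_mul, degree_eq_natDegree hq] at hmem
    rw [degree_eq_natDegree hP.ne_zero] at hmem
    norm_cast at hmem
    omega
  refine ⟨fun p j => (r p j.rev).coeff 0 * distinctVal a p ^ (j.val + 1), ?_, ?_⟩
  · refine (isCharCoeff_iff ha _).2 ?_
    rw [hf, hq, zero_mul, zero_add]
    refine Finset.sum_congr rfl fun p _ => Finset.sum_congr rfl fun j _ => ?_
    have := (pow_pos (distinctVal_pos ha p) (j.rev.val + 1)).ne'
    rw [remainder, Fin.rev_rev, mul_div_cancel_right₀ _ this, ← hrC]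
  · intro χ hχ
    have h1 := (isCharCoeff_iff ha _).1 hχ
    obtain ⟨-, h2⟩ := quo_mul_prod_pow_add_sum_rem_mul_prod_pow_unique
      (s := Finset.univ) (g := linFactor a) (fun p _ => monic_linFactor a p) (isCoprime_linFactor a)
      (q₁ := 0) (q₂ := q) (hdeg χ) hr
      (by rw [← hf, h1, zero_mul, zero_add])
    funext p j
    have h3 : remainder χ p j.rev = r p j.rev := 
      congrFun (h2 p (Finset.mem_univ p)) _
    have := (pow_pos (distinctVal_pos ha p) (j.val + 1)).ne'
    rw [← h3, remainder, coeff_C_zero, Fin.rev_rev, div_mul_cancel₀ _ this]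

lemma isCharCoeff_charCoeff (hM : 1 ≤ M) (ha : ∀ i, 0 < a i) : IsCharCoeff a (charCoeff a) := by
  have h := (existsUnique_isCharCoeff hM ha).exists
  rw [charCoeff, dif_pos h]
  exact h.choose_spec

end PartialFractions

/-! ### Uniqueness of Laplace transforms -/

section Laplace

open scoped NNReal BoundedContinuousFunction

/-- The bounded continuous function `exp (-x)` on the half-line. -/
def expNeg : ℝ≥0 →ᵇ ℝ :=
  BoundedContinuousFunction.ofNormedAddCommGroup (fun x : ℝ≥0 => Real.exp (-x))
    (by fun_prop) 1 (fun x => by simp [Real.abs_exp])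

lemma ext_of_integral_expNeg_pow {μ ν : Measure ℝ≥0} [IsFiniteMeasure μ] [IsFiniteMeasure ν]
    (h : ∀ n : ℕ, ∫ x, Real.exp (-(n * x)) ∂μ = ∫ x, Real.exp (-(n * x)) ∂ν) : μ = ν := by
  refine ext_of_forall_mem_subalgebra_integral_eq_of_polish (𝕜 := ℝ)
    (A := StarAlgebra.adjoin ℝ {expNeg}) ?_ ?_
  · intro x y hxy
    refine ⟨expNeg, ⟨BoundedContinuousFunction.toContinuousMapStarₐ ℝ expNeg,
      ⟨expNeg, StarAlgebra.self_mem_adjoin_singleton ℝ _, rfl⟩, rfl⟩, fun h => hxy ?_⟩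
    have := Real.exp_injective h
    exact NNReal.coe_injective (neg_injective this)
  · intro g hg
    have hg' : g ∈ Algebra.adjoin ℝ {expNeg} := by
      have : (StarAlgebra.adjoin ℝ {expNeg}).toSubalgebra = Algebra.adjoin ℝ {expNeg} := by
        rw [StarAlgebra.adjoin_toSubalgebra]
        congr 1
        simp only [Set.star_singleton, Set.union_eq_left, Set.singleton_subset_iff,
          Set.mem_singleton_iff]
        ext x
        simp
      rw [← this]; exact hg
    rw [Algebra.adjoin_singleton_eq_range_aeval] at hg'
    obtain ⟨p, rfl⟩ := hg'
    have hp (x : ℝ≥0) : (Polynomial.aeval expNeg p) x =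
        ∑ i ∈ Finset.range (p.natDegree + 1), p.coeff i * Real.exp (-(i * x)) := by
      rw [Polynomial.aeval_eq_sum_range, BoundedContinuousFunction.sum_apply]
      refine Finset.sum_congr rfl fun i _ => ?_
      simp [expNeg, ← Real.exp_nat_mul]
    have hint (μ : Measure ℝ≥0) [IsFiniteMeasure μ] (i : ℕ) :
        Integrable (fun x : ℝ≥0 => p.coeff i * Real.exp (-(i * x))) μ := by
      refine Integrable.const_mul (Integrable.of_bound (by fun_prop) 1 (.of_forall fun x => ?_)) _
      rw [Real.norm_eq_abs, Real.abs_exp, Real.exp_le_one_iff]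
      exact neg_nonpos.2 (by positivity)
    refine (integral_congr_ae (.of_forall hp)).trans
      (Eq.trans ?_ (integral_congr_ae (.of_forall hp)).symm)
    rw [integral_finsetSum _ fun i _ => hint μ i, integral_finsetSum _ fun i _ => hint ν i]
    simp_rw [integral_const_mul, h]

/-- A finite measure on the half-line `[0, ∞)` is determined by its Laplace transform at the
natural numbers. -/
lemma ext_of_laplace {μ ν : Measure ℝ} [IsFiniteMeasure μ] [IsFiniteMeasure ν]
    (hμ : ∀ᵐ x ∂μ, 0 ≤ x) (hν : ∀ᵐ x ∂ν, 0 ≤ x)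
    (h : ∀ n : ℕ, ∫ x, Real.exp (-(n * x)) ∂μ = ∫ x, Real.exp (-(n * x)) ∂ν) : μ = ν := by
  have key {μ : Measure ℝ} (hμ : ∀ᵐ x ∂μ, 0 ≤ x) :
      (μ.map Real.toNNReal).map ((↑) : ℝ≥0 → ℝ) = μ := by
    rw [Measure.map_map (by fun_prop) (by fun_prop)]
    conv_rhs => rw [← Measure.map_id (μ := μ)]
    exact Measure.map_congr (hμ.mono fun x hx => Real.coe_toNNReal x hx)
  have key2 {μ : Measure ℝ} (hμ : ∀ᵐ x ∂μ, 0 ≤ x) (n : ℕ) :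
      ∫ x, Real.exp (-(n * x)) ∂(μ.map Real.toNNReal) = ∫ x, Real.exp (-(n * x)) ∂μ := by
    rw [integral_map (by fun_prop) (by fun_prop)]
    exact integral_congr_ae (hμ.mono fun x hx => by simp only [Real.coe_toNNReal x hx])
  rw [← key hμ, ← key hν, ext_of_integral_expNeg_pow (μ := μ.map Real.toNNReal)
    (ν := ν.map Real.toNNReal) fun n => by rw [key2 hμ, key2 hν, h]]

/-- If a function `f` on the half-line, not assumed to be nonnegative, has the Laplace transform
of a finite measure, then it is a density of that measure. -/
lemma integral_eq_of_laplace {ν : Measure ℝ} [IsFiniteMeasure ν] (hν : ∀ᵐ x ∂ν, 0 ≤ x)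
    {f : ℝ → ℝ} (hf : IntegrableOn f (Set.Ioi 0))
    (h : ∀ n : ℕ, ∫ x, Real.exp (-(n * x)) ∂ν =
      ∫ x in Set.Ioi 0, f x * Real.exp (-(n * x)))
    {g : ℝ → ℝ} {C : ℝ} (hg : Measurable g) (hC : ∀ x, |g x| ≤ C) :
    ∫ x, g x ∂ν = ∫ x in Set.Ioi 0, f x * g x := by
  have hfm := hf.aemeasurable
  let lam := volume.restrict (Set.Ioi (0 : ℝ))
  let μp := lam.withDensity fun x => ENNReal.ofReal (f x)
  let μm := lam.withDensity fun x => ENNReal.ofReal (-f x)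
  have : IsFiniteMeasure μp := isFiniteMeasure_withDensity_ofReal hf.2
  have : IsFiniteMeasure μm := isFiniteMeasure_withDensity_ofReal hf.neg.2
  have hlam : ∀ᵐ x ∂lam, 0 ≤ x :=
    (ae_restrict_mem measurableSet_Ioi).mono fun x hx => le_of_lt hx
  have hp : ∀ᵐ x ∂μp, 0 ≤ x := (withDensity_absolutelyContinuous _ _).ae_le hlam
  have hm : ∀ᵐ x ∂μm, 0 ≤ x := (withDensity_absolutelyContinuous _ _).ae_le hlam
  have hd {w g : ℝ → ℝ} (hw : AEMeasurable w lam) :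
      ∫ x, g x ∂(lam.withDensity fun x => ENNReal.ofReal (w x)) =
        ∫ x, max (w x) 0 * g x ∂lam := by
    rw [integral_withDensity_eq_integral_toReal_smul₀ hw.ennreal_ofReal (by simp)]
    simp only [ENNReal.toReal_ofReal', smul_eq_mul]
  have split {g : ℝ → ℝ} {C : ℝ} (hg : Measurable g) (hC : ∀ᵐ x ∂lam, ‖g x‖ ≤ C) :
      ∫ x, g x ∂μp - ∫ x, g x ∂μm = ∫ x, f x * g x ∂lam := by
    rw [hd hfm, hd (w := fun x => -f x) hfm.neg, ← integral_sub]
    · refine integral_congr_ae (.of_forall fun x => ?_)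
      simp only
      rw [← sub_mul]
      congr 1
      rcases le_total (f x) 0 with h0 | h0 <;> simp [h0]
    · exact (hf.pos_part).mul_bdd hg.aestronglyMeasurable hC
    · exact (hf.neg.pos_part).mul_bdd hg.aestronglyMeasurable hC
  have heq : ν + μm = μp := by
    refine ext_of_laplace (by rw [ae_add_measure_iff]; exact ⟨hν, hm⟩) hp fun n => ?_
    have hb {μ : Measure ℝ} (hμ : ∀ᵐ x ∂μ, 0 ≤ x) : ∀ᵐ x ∂μ, ‖Real.exp (-(n * x))‖ ≤ 1 := by
      refine hμ.mono fun x hx => ?_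
      rw [Real.norm_eq_abs, Real.abs_exp, Real.exp_le_one_iff, Left.neg_nonpos_iff]
      positivity
    rw [integral_add_measure (.of_bound (by fun_prop) 1 (hb hν)) (.of_bound (by fun_prop) 1 (hb hm)),
      h, ← split (by fun_prop) (hb hlam), sub_add_cancel]
  have hC' {μ : Measure ℝ} : ∀ᵐ x ∂μ, ‖g x‖ ≤ C := .of_forall hC
  rw [← split hg hC', ← heq, integral_add_measure (.of_bound hg.aestronglyMeasurable C hC')
    (.of_bound hg.aestronglyMeasurable C hC'), add_sub_cancel_right]

end Laplace

/-! ### Complex Gaussian vectors -/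

instance : IsProbabilityMeasure stdComplexGaussian :=
  Measure.isProbabilityMeasure_map (by fun_prop)

lemma integral_stdComplexGaussian {E : Type*} [NormedAddCommGroup E] [NormedSpace ℝ E]
    (f : ℂ → E) : ∫ z, f z ∂stdComplexGaussian =
      ∫ p : ℝ × ℝ, f ⟨p.1, p.2⟩ ∂((gaussianReal 0 (1 / 2)).prod (gaussianReal 0 (1 / 2))) := by
  rw [stdComplexGaussian, integral_map_equiv]
  rfl

lemma charFun_stdComplexGaussian (t : ℂ) :
    charFun stdComplexGaussian t = Complex.exp (-(‖t‖ ^ 2 : ℝ) / 4) := by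
  have h1 (s : ℝ) : ∫ x : ℝ, Complex.exp (s * x * Complex.I) ∂(gaussianReal 0 (1 / 2)) =
      Complex.exp (-(s ^ 2 : ℝ) / 4) := by
    have := charFun_gaussianReal (μ := 0) (v := 1 / 2) s
    rw [charFun_apply_real] at this
    rw [this]
    congr 1
    push_cast
    ring
  rw [charFun_apply, integral_stdComplexGaussian]
  have h2 (p : ℝ × ℝ) : Complex.exp (inner ℝ (⟨p.1, p.2⟩ : ℂ) t * Complex.I) =
      Complex.exp (t.re * p.1 * Complex.I) * Complex.exp (t.im * p.2 * Complex.I) := by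
    rw [← Complex.exp_add, Complex.inner]
    congr 1
    simp
    ring
  simp_rw [h2]
  rw [integral_prod_mul (fun x : ℝ => Complex.exp (t.re * x * Complex.I))
    (fun x : ℝ => Complex.exp (t.im * x * Complex.I)), h1, h1, ← Complex.exp_add, Complex.sq_norm,
    Complex.normSq_apply]
  congr 1
  push_cast
  ring

/-- Isotropy of a complex Gaussian vector: its inner product with a fixed unit vector is again
a standard complex Gaussian variable. -/
lemma map_dotProduct_pi_stdComplexGaussian {N : ℕ} {v : Fin N → ℂ} (hv : ∑ n, ‖v n‖ ^ 2 = 1) :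
    (Measure.pi fun _ : Fin N => stdComplexGaussian).map (fun z => v ⬝ᵥ z) =
      stdComplexGaussian := by
  have hm (n : Fin N) : AEMeasurable (fun z : ℂ => v n * z) stdComplexGaussian := by fun_prop
  have (n : Fin N) : IsProbabilityMeasure (stdComplexGaussian.map fun z => v n * z) :=
    Measure.isProbabilityMeasure_map (hm n)
  have h1 : (Measure.pi fun _ : Fin N => stdComplexGaussian).map (fun z => v ⬝ᵥ z) =
      (Measure.pi fun n : Fin N => stdComplexGaussian.map fun z => v n * z).map
        (fun w => ∑ n, w n) := by
    rw [← Measure.pi_map_pi hm, Measure.map_map (by fun_prop) (by fun_prop)]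
    rfl
  refine Measure.ext_of_charFun (funext fun t => ?_)
  rw [h1, charFun_map_sum_pi_eq_prod, Finset.prod_apply]
  have h2 (n : Fin N) : charFun (stdComplexGaussian.map fun z => v n * z) t =
      Complex.exp (‖v n‖ ^ 2 * (-(‖t‖ ^ 2 : ℝ) / 4)) := by
    have : charFun (stdComplexGaussian.map fun z => v n * z) t =
        charFun stdComplexGaussian (star (v n) * t) := by
      rw [charFun_apply, charFun_apply, integral_map (hm n) (by fun_prop)]
      refine integral_congr_ae (.of_forall fun z => ?_)
      simp only [Complex.inner, map_mul]
      congr 4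
      simp
      ring
    rw [this, charFun_stdComplexGaussian, norm_mul, norm_star]
    congr 1
    push_cast
    ring
  simp_rw [h2]
  rw [← Complex.exp_sum, ← Finset.sum_mul, charFun_stdComplexGaussian]
  have : (∑ n, (‖v n‖ : ℂ) ^ 2) = 1 := by exact_mod_cast hv
  rw [this, one_mul]

lemma integral_exp_neg_sq_gaussianReal (s : ℝ) :
    ∫ x, Real.exp (-(s * x ^ 2)) ∂(gaussianReal 0 (1 / 2)) = (√(1 + s))⁻¹ := by
  rw [integral_gaussianReal_eq_integral_smul (by norm_num)]
  have h (x : ℝ) : gaussianPDFReal 0 (1 / 2) x • Real.exp (-(s * x ^ 2)) =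
      (√Real.pi)⁻¹ * Real.exp (-(1 + s) * x ^ 2) := by
    rw [gaussianPDFReal, smul_eq_mul, mul_assoc, ← Real.exp_add]
    congr 1
    · congr 2; push_cast; ring
    · congr 1; push_cast; ring
  simp_rw [h]
  rw [integral_const_mul, integral_gaussian, Real.sqrt_div Real.pi_pos.le, ← mul_div_assoc,
    inv_mul_cancel₀ (Real.sqrt_pos.2 Real.pi_pos).ne', one_div]

/-- The squared modulus of a standard complex Gaussian variable has the Laplace transform of the
exponential law. -/
lemma integral_exp_neg_normSq_stdComplexGaussian {s : ℝ} (hs : 0 ≤ s) :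
    ∫ z, Real.exp (-(s * ‖z‖ ^ 2)) ∂stdComplexGaussian = (1 + s)⁻¹ := by
  rw [integral_stdComplexGaussian]
  have h (p : ℝ × ℝ) : Real.exp (-(s * ‖(⟨p.1, p.2⟩ : ℂ)‖ ^ 2)) =
      Real.exp (-(s * p.1 ^ 2)) * Real.exp (-(s * p.2 ^ 2)) := by
    rw [← Real.exp_add, Complex.sq_norm, Complex.normSq_apply]
    congr 1
    ring
  simp_rw [h]
  rw [integral_prod_mul (fun x : ℝ => Real.exp (-(s * x ^ 2)))
    (fun x : ℝ => Real.exp (-(s * x ^ 2))), integral_exp_neg_sq_gaussianReal, ← mul_inv,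
    Real.mul_self_sqrt (by linarith)]

/-- The Laplace transform of a weighted sum of squared moduli of independent standard complex
Gaussian variables. -/
lemma integral_exp_neg_weighted_sum {ι : Type*} [Fintype ι] {a : ι → ℝ} (ha : ∀ i, 0 ≤ a i) {s : ℝ}
    (hs : 0 ≤ s) :
    ∫ z : ι → ℂ, Real.exp (-(s * ∑ i, ‖z i‖ ^ 2 * a i)) ∂(Measure.pi fun _ => stdComplexGaussian) =
      (∏ i, (1 + s * a i))⁻¹ := by
  have h (z : ι → ℂ) : Real.exp (-(s * ∑ i, ‖z i‖ ^ 2 * a i)) =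
      ∏ i, Real.exp (-(s * a i * ‖z i‖ ^ 2)) := by
    rw [← Real.exp_sum, Finset.mul_sum, ← Finset.sum_neg_distrib]
    congr 1
    exact Finset.sum_congr rfl fun i _ => by ring
  simp_rw [h]
  rw [integral_fintype_prod_eq_prod (f := fun i (z : ℂ) => Real.exp (-(s * a i * ‖z‖ ^ 2))),
    ← Finset.prod_inv_distrib]
  exact Finset.prod_congr rfl fun i _ =>
    integral_exp_neg_normSq_stdComplexGaussian (mul_nonneg hs (ha i))

/-! ### Erlang laws and mixtures -/

section Erlang

lemma integral_pow_mul_exp_neg (q : ℕ) {r : ℝ} (hr : 0 < r) :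
    ∫ x in Set.Ioi (0 : ℝ), x ^ q * Real.exp (-(r * x)) = q ! / r ^ (q + 1) := by
  have h := Real.integral_rpow_mul_exp_neg_mul_Ioi (a := q + 1) (by positivity) hr
  rw [Real.Gamma_nat_eq_factorial] at h
  have h2 : (1 / r) ^ ((q : ℝ) + 1) = 1 / r ^ (q + 1) := by
    rw [← Nat.cast_add_one, Real.rpow_natCast, _root_.one_div_pow]
  rw [h2] at h
  simp only [add_sub_cancel_right, Real.rpow_natCast] at h
  rw [h]
  ring

lemma integrableOn_pow_mul_exp_neg (q : ℕ) {r : ℝ} (hr : 0 < r) :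
    IntegrableOn (fun x : ℝ => x ^ q * Real.exp (-(r * x))) (Set.Ioi 0) := by
  by_contra h
  have := integral_undef h
  rw [integral_pow_mul_exp_neg q hr] at this
  exact absurd this (by positivity)

/-- The density of the Erlang law with shape `n + 1` and rate `1`. -/
def erlangPDF (n : ℕ) (x : ℝ) : ℝ := x ^ n * Real.exp (-x) / n !

/-- The Erlang law with shape `n + 1` and rate `1`, that is, the law of a sum of `n + 1`
independent standard exponential variables. -/
def erlang (n : ℕ) : Measure ℝ :=
  (volume.restrict (Set.Ioi 0)).withDensity fun x => ENNReal.ofReal (erlangPDF n x)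

lemma measurable_erlangPDF (n : ℕ) : Measurable (erlangPDF n) := by
  unfold erlangPDF; fun_prop

lemma integrableOn_erlangPDF (n : ℕ) : IntegrableOn (erlangPDF n) (Set.Ioi 0) := by
  have := (integrableOn_pow_mul_exp_neg n one_pos).div_const (n ! : ℝ)
  simp only [one_mul] at this
  exact this

instance (n : ℕ) : IsFiniteMeasure (erlang n) :=
  isFiniteMeasure_withDensity_ofReal (integrableOn_erlangPDF n).2

lemma erlang_pos (n : ℕ) : ∀ᵐ x ∂(erlang n), 0 < x :=
  (withDensity_absolutelyContinuous _ _).ae_le (ae_restrict_mem measurableSet_Ioi)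

lemma erlang_nonneg (n : ℕ) : ∀ᵐ x ∂(erlang n), 0 ≤ x :=
  (erlang_pos n).mono fun _ hx => hx.le

lemma laplace_erlang (n : ℕ) {s : ℝ} (hs : 0 ≤ s) :
    ∫ x, Real.exp (-(s * x)) ∂(erlang n) = ((1 + s) ^ (n + 1))⁻¹ := by
  rw [erlang, integral_withDensity_eq_integral_toReal_smul
    (measurable_erlangPDF n).ennreal_ofReal (by simp)]
  have h : ∀ x ∈ Set.Ioi (0 : ℝ), (ENNReal.ofReal (erlangPDF n x)).toReal • Real.exp (-(s * x)) =
      (n ! : ℝ)⁻¹ * (x ^ n * Real.exp (-((1 + s) * x))) := fun x hx => by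
    have hx : 0 < x := hx
    rw [ENNReal.toReal_ofReal (by unfold erlangPDF; positivity), erlangPDF, smul_eq_mul,
      add_mul, neg_add, Real.exp_add]
    ring_nf
  rw [setIntegral_congr_fun measurableSet_Ioi h, integral_const_mul,
    integral_pow_mul_exp_neg n (by linarith)]
  have : (n ! : ℝ) ≠ 0 := by positivity
  field_simp

lemma measurable_sqNorm (N : ℕ) : Measurable (sqNorm (N := N)) := by unfold sqNorm; fun_prop

/-- The squared norm of a standard complex Gaussian vector has an Erlang law. -/
lemma map_sqNorm (n : ℕ) :
    (Measure.pi fun _ : Fin (n + 1) => stdComplexGaussian).map sqNorm = erlang n := by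
  have hm := measurable_sqNorm (n + 1)
  have : IsProbabilityMeasure
      ((Measure.pi fun _ : Fin (n + 1) => stdComplexGaussian).map sqNorm) :=
    Measure.isProbabilityMeasure_map hm.aemeasurable
  refine ext_of_laplace ?_ (erlang_nonneg n) fun k => ?_
  · refine (ae_map_iff hm.aemeasurable measurableSet_Ici).2 (.of_forall fun z => ?_)
    exact Finset.sum_nonneg fun i _ => by positivity
  · rw [integral_map hm.aemeasurable (by fun_prop), laplace_erlang n (Nat.cast_nonneg k)]
    have := integral_exp_neg_weighted_sum (ι := Fin (n + 1)) (a := fun _ => 1)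
      (fun _ => zero_le_one) (s := k) (Nat.cast_nonneg k)
    simpa [sqNorm] using this

/-- The tail of the Erlang law is a Poisson sum. -/
lemma erlang_Ici (n : ℕ) {y : ℝ} (hy : 0 ≤ y) :
    erlang n (Set.Ici y) =
      ENNReal.ofReal (Real.exp (-y) * ∑ m ∈ Finset.range (n + 1), y ^ m * (1 / (m ! : ℝ))) := by
  have hd (x : ℝ) : HasDerivAt (fun x : ℝ => -(Real.exp (-x) *
      ∑ m ∈ Finset.range (n + 1), x ^ m * (1 / (m ! : ℝ)))) (erlangPDF n x) x := by
    induction n with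
    | zero =>
      simp only [zero_add, Finset.range_one, Finset.sum_singleton, pow_zero, Nat.factorial_zero,
        erlangPDF]
      have := (hasDerivAt_neg x).exp.neg
      refine (this.congr_deriv ?_).congr_of_eventuallyEq (.of_forall fun x => ?_)
      · simp
      · simp
    | succ n ih =>
      have h1 : HasDerivAt (fun x : ℝ => -(Real.exp (-x) *
          (x ^ (n + 1) * (1 / ((n + 1)! : ℝ)))))
          (-(Real.exp (-x) * (-1) * (x ^ (n + 1) * (1 / ((n + 1)! : ℝ))) +
            Real.exp (-x) * (((n + 1 : ℕ) : ℝ) * x ^ n * (1 / ((n + 1)! : ℝ))))) x :=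
        ((hasDerivAt_neg x).exp.mul ((hasDerivAt_pow (n + 1) x).mul_const _)).neg
      have h2 := ih.add h1
      refine (h2.congr_deriv ?_).congr_of_eventuallyEq (.of_forall fun x => ?_)
      · simp only [erlangPDF, Nat.factorial_succ]
        push_cast
        field_simp
        ring
      · simp only [Finset.sum_range_succ _ (n + 1), Pi.add_apply]
        ring
  have hlim : Filter.Tendsto (fun x : ℝ => -(Real.exp (-x) *
      ∑ m ∈ Finset.range (n + 1), x ^ m * (1 / (m ! : ℝ)))) Filter.atTop (nhds 0) := by
    have : Filter.Tendsto (fun x : ℝ => -(∑ m ∈ Finset.range (n + 1),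
        (x ^ m * Real.exp (-x)) * (1 / (m ! : ℝ)))) Filter.atTop
        (nhds (-(∑ m ∈ Finset.range (n + 1), 0 * (1 / (m ! : ℝ))))) :=
      (tendsto_finsetSum _ fun m _ =>
        (Real.tendsto_pow_mul_exp_neg_atTop_nhds_zero m).mul_const _).neg
    simp only [zero_mul, Finset.sum_const_zero, neg_zero] at this
    refine this.congr fun x => ?_
    rw [Finset.mul_sum]
    congr 1
    exact Finset.sum_congr rfl fun m _ => by ring
  have hint : IntegrableOn (erlangPDF n) (Set.Ioi y) :=
    (integrableOn_erlangPDF n).mono_set (Set.Ioi_subset_Ioi hy)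
  have hval := integral_Ioi_of_hasDerivAt_of_tendsto' (fun x _ => hd x) hint hlim
  rw [erlang, withDensity_apply _ measurableSet_Ici, Measure.restrict_restrict measurableSet_Ici]
  have hset : (Set.Ici y ∩ Set.Ioi 0 : Set ℝ) =ᵐ[volume] Set.Ioi y := by
    have : (Set.Ici y ∩ Set.Ioi 0 : Set ℝ) =ᵐ[volume] (Set.Ioi y ∩ Set.Ioi 0 : Set ℝ) :=
      Ioi_ae_eq_Ici.symm.inter (ae_eq_refl _)
    rwa [Set.Ioi_inter_Ioi, sup_of_le_left hy] at this
  rw [Measure.restrict_congr_set hset, ← ofReal_integral_eq_lintegral_ofReal hint, hval]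
  · simp
  · refine (ae_restrict_mem measurableSet_Ioi).mono fun x hx => ?_
    have : 0 < x := hy.trans_lt hx
    simp only [Pi.zero_apply, erlangPDF]
    positivity

variable {M : ℕ}

/-- The law of the total interference power `∑ i, |z i|² a i` for independent standard complex
Gaussian `z i`. -/
def interferenceLaw (a : Fin M → ℝ) : Measure ℝ :=
  (Measure.pi fun _ : Fin M => stdComplexGaussian).map fun z => ∑ i, ‖z i‖ ^ 2 * a i

lemma measurable_weighted_sum (a : Fin M → ℝ) :
    Measurable fun z : Fin M → ℂ => ∑ i, ‖z i‖ ^ 2 * a i := by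
  fun_prop

instance (a : Fin M → ℝ) : IsProbabilityMeasure (interferenceLaw a) :=
  Measure.isProbabilityMeasure_map (measurable_weighted_sum a).aemeasurable

lemma interferenceLaw_nonneg {a : Fin M → ℝ} (ha : ∀ i, 0 < a i) :
    ∀ᵐ x ∂(interferenceLaw a), 0 ≤ x := by
  refine (ae_map_iff (measurable_weighted_sum a).aemeasurable measurableSet_Ici).2 (.of_forall fun z => ?_)
  exact Finset.sum_nonneg fun i _ => mul_nonneg (by positivity) (ha i).le

/-- The interference power has as its density the mixture of Gamma densities whose weights are the
characteristic coefficients; both have the Laplace transform `det(I + ξ diag(a))⁻¹`. -/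
lemma integral_interferenceLaw (hM : 1 ≤ M) {a : Fin M → ℝ} (ha : ∀ i, 0 < a i) {g : ℝ → ℝ} {C : ℝ}
    (hg : Measurable g) (hC : ∀ x, |g x| ≤ C) :
    ∫ x, g x ∂(interferenceLaw a) = ∑ p, ∑ q : Fin (multiplicity a p),
      charCoeff a p q * ((distinctVal a p ^ (q.val + 1))⁻¹ / (q.val)!) *
        ∫ x in Set.Ioi 0, x ^ q.val * Real.exp (-(1 / distinctVal a p * x)) * g x := by
  have hinv (p) : 0 < 1 / distinctVal a p := one_div_pos.2 (distinctVal_pos ha p)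
  -- integration of the mixture against any bounded function
  have hmix {g : ℝ → ℝ} {C : ℝ} (hg : Measurable g)
      (hC : ∀ᵐ x ∂(volume.restrict (Set.Ioi (0 : ℝ))), ‖g x‖ ≤ C) :
      ∫ x in Set.Ioi 0, (∑ p, ∑ q : Fin (multiplicity a p),
        charCoeff a p q * ((distinctVal a p ^ (q.val + 1))⁻¹ / (q.val)!) *
          (x ^ q.val * Real.exp (-(1 / distinctVal a p * x)))) * g x =
      ∑ p, ∑ q : Fin (multiplicity a p),
        charCoeff a p q * ((distinctVal a p ^ (q.val + 1))⁻¹ / (q.val)!) *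
          ∫ x in Set.Ioi 0, x ^ q.val * Real.exp (-(1 / distinctVal a p * x)) * g x := by
    have hi (p) (q : Fin (multiplicity a p)) :=
      ((integrableOn_pow_mul_exp_neg q.val (hinv p)).mul_bdd hg.aestronglyMeasurable hC).const_mul
        (charCoeff a p q * ((distinctVal a p ^ (q.val + 1))⁻¹ / (q.val)!))
    simp_rw [Finset.sum_mul, mul_assoc (_ * _ : ℝ) (_ * _ : ℝ) (_ : ℝ)]
    rw [integral_finsetSum _ fun p _ => integrable_finsetSum _ fun q _ => hi p q]
    refine Finset.sum_congr rfl fun p _ => ?_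
    rw [integral_finsetSum _ fun q _ => hi p q]
    simp_rw [integral_const_mul]
  rw [← hmix hg (.of_forall hC)]
  refine integral_eq_of_laplace (interferenceLaw_nonneg ha) ?_ ?_ hg hC
  · exact integrable_finsetSum _ fun p _ => integrable_finsetSum _ fun q _ =>
      (integrableOn_pow_mul_exp_neg q.val (hinv p)).const_mul _
  intro n
  have hb : ∀ᵐ x ∂(volume.restrict (Set.Ioi (0 : ℝ))), ‖Real.exp (-(n * x))‖ ≤ 1 := by
    refine (ae_restrict_mem measurableSet_Ioi).mono fun x (hx : 0 < x) => ?_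
    rw [Real.norm_eq_abs, Real.abs_exp, Real.exp_le_one_iff, Left.neg_nonpos_iff]
    positivity
  have hdet : (1 + (n : ℝ) • diagonal a).det = ∏ i, (1 + n * a i) := by
    rw [det_one_add_smul_diagonal, ← prod_eq_prod_distinctVal a (fun x => 1 + n * x)]
  have hpos : (1 + (n : ℝ) • diagonal a).det ≠ 0 := by
    rw [hdet]
    exact Finset.prod_ne_zero_iff.2 fun i _ => by have := ha i; positivity
  rw [hmix (by fun_prop) hb, interferenceLaw,
    integral_map (measurable_weighted_sum a).aemeasurable (by fun_prop),
    integral_exp_neg_weighted_sum (fun i => (ha i).le) (Nat.cast_nonneg n), ← hdet,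
    isCharCoeff_charCoeff hM ha n hpos]
  refine Finset.sum_congr rfl fun p _ => Finset.sum_congr rfl fun q _ => ?_
  have hd := distinctVal_pos ha p
  have h1 (x : ℝ) : x ^ q.val * Real.exp (-(1 / distinctVal a p * x)) * Real.exp (-(n * x)) =
      x ^ q.val * Real.exp (-((1 / distinctVal a p + n) * x)) := by
    rw [mul_assoc, ← Real.exp_add]
    ring_nf
  simp_rw [h1]
  rw [integral_pow_mul_exp_neg _ (by positivity)]
  have h2 : 1 / distinctVal a p + n = (1 + n * distinctVal a p) / distinctVal a p := by
    field_simp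
  rw [h2, div_pow]
  have : ((q.val)! : ℝ) ≠ 0 := by positivity
  field_simp

end Erlang

/-! ### The Bessel integral -/

/-- The integrand `x ^ (ν - 1) exp (-x - β / x)`, whose integral over the half-line is a Bessel
function of `β`. -/
def besselKernel (ν β x : ℝ) : ℝ := x ^ (ν - 1) * Real.exp (-x - β / x)

lemma besselKernel_nonneg (ν β : ℝ) {x : ℝ} (hx : 0 < x) : 0 ≤ besselKernel ν β x := by
  unfold besselKernel; positivity

lemma measurable_besselKernel (ν : ℝ) :
    Measurable fun p : ℝ × ℝ => besselKernel ν p.1 p.2 := by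
  unfold besselKernel; fun_prop

/-- The factor `exp (-β / x)` vanishes at the origin faster than any power, so that the kernel is
integrable for every order. -/
lemma integrableOn_besselKernel (ν : ℝ) {β : ℝ} (hβ : 0 < β) :
    IntegrableOn (besselKernel ν β) (Set.Ioi 0) := by
  obtain ⟨n, hn⟩ := exists_nat_gt (-ν)
  have hG := (Real.GammaIntegral_convergent (s := ν + n) (by linarith)).const_mul
    ((n ! : ℝ) / β ^ n)
  refine hG.mono' ((measurable_besselKernel ν).comp measurable_prodMk_left).aestronglyMeasurable
    ((ae_restrict_mem measurableSet_Ioi).mono fun x (hx : 0 < x) => ?_)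
  rw [Real.norm_of_nonneg (besselKernel_nonneg ν β hx)]
  have h1 := Real.pow_div_factorial_le_exp (β / x) (by positivity) n
  have h2 : Real.exp (-(β / x)) ≤ n ! / β ^ n * x ^ n := by
    rw [Real.exp_neg]
    refine (inv_anti₀ (by positivity) h1).trans (le_of_eq ?_)
    rw [div_pow]
    field_simp
  have h3 : x ^ (ν + n - 1) = x ^ (ν - 1) * x ^ n := by
    rw [← Real.rpow_natCast, ← Real.rpow_add hx]
    ring_nf
  rw [besselKernel, h3, sub_eq_add_neg (-x), Real.exp_add]
  calc x ^ (ν - 1) * (Real.exp (-x) * Real.exp (-(β / x)))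
      ≤ x ^ (ν - 1) * (Real.exp (-x) * (n ! / β ^ n * x ^ n)) := by gcongr
    _ = _ := by ring

/-- The substitution `x = √β e ^ t` turns the kernel into the integrand of the Bessel function. -/
lemma integral_besselKernel (ν : ℝ) {β : ℝ} (hβ : 0 < β) :
    ∫ x in Set.Ioi 0, besselKernel ν β x = 2 * β ^ (ν / 2) * besselK ν (2 * √β) := by
  have hc : 0 < √β := Real.sqrt_pos.2 hβ
  have himg : (fun t => √β * Real.exp t) '' Set.univ = Set.Ioi 0 := by
    ext x
    simp only [Set.image_univ, Set.mem_range, Set.mem_Ioi]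
    constructor
    · rintro ⟨t, rfl⟩; positivity
    · intro hx
      exact ⟨Real.log (x / √β), by rw [Real.exp_log (by positivity)]; field_simp⟩
  have hderiv : ∀ t ∈ (Set.univ : Set ℝ),
      HasDerivWithinAt (fun t => √β * Real.exp t) (√β * Real.exp t) Set.univ t := fun t _ =>
    ((Real.hasDerivAt_exp t).const_mul _).hasDerivWithinAt
  have hinj : Set.InjOn (fun t => √β * Real.exp t) Set.univ := fun s _ t _ h =>
    Real.exp_injective (mul_left_cancel₀ hc.ne' h)
  have hker (t : ℝ) : |√β * Real.exp t| • besselKernel ν β (√β * Real.exp t) =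
      β ^ (ν / 2) * (Real.exp (-(2 * √β) * Real.cosh t) * Real.exp (ν * t)) := by
    have hx : 0 < √β * Real.exp t := by positivity
    rw [abs_of_pos hx, smul_eq_mul, besselKernel, ← mul_assoc]
    have h1 : √β * Real.exp t * (√β * Real.exp t) ^ (ν - 1) = β ^ (ν / 2) * Real.exp (ν * t) := by
      rw [Real.rpow_sub_one hx.ne', mul_div_cancel₀ _ hx.ne',
        Real.mul_rpow hc.le (Real.exp_pos t).le, ← Real.exp_mul, Real.sqrt_eq_rpow,
        ← Real.rpow_mul hβ.le]
      ring_nf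
    have h2 : -(√β * Real.exp t) - β / (√β * Real.exp t) = -(2 * √β) * Real.cosh t := by
      have : β / (√β * Real.exp t) = √β * Real.exp (-t) := by
        rw [Real.exp_neg, div_eq_iff hx.ne']
        have := (Real.exp_pos t).ne'
        field_simp
        exact (Real.sq_sqrt hβ.le).symm
      rw [this, Real.cosh_eq]
      ring
    rw [h1, h2]
    ring
  have hint : Integrable fun t => β ^ (ν / 2) *
      (Real.exp (-(2 * √β) * Real.cosh t) * Real.exp (ν * t)) := by
    have := (integrableOn_image_iff_integrableOn_abs_deriv_smul MeasurableSet.univ hderiv hinj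
      (besselKernel ν β)).1 (himg.symm ▸ integrableOn_besselKernel ν hβ)
    simpa only [hker, integrableOn_univ] using this
  have hpos : 0 < β ^ (ν / 2) := Real.rpow_pos_of_pos hβ _
  have hint' : Integrable fun t => Real.exp (-(2 * √β) * Real.cosh t) * Real.exp (ν * t) :=
    (integrable_const_mul_iff hpos.ne'.isUnit _).1 hint
  have hsub := integral_image_eq_integral_abs_deriv_smul MeasurableSet.univ hderiv hinj
    (besselKernel ν β)
  rw [himg] at hsub
  simp_rw [hker, setIntegral_univ, integral_const_mul] at hsub
  -- the odd part of `exp (ν t)` integrates to zero against the even weight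
  have heven : ∫ t, Real.exp (-(2 * √β) * Real.cosh t) * Real.exp (ν * t) =
      ∫ t, Real.exp (-(2 * √β) * Real.cosh |t|) * Real.cosh (ν * |t|) := by
    have hneg := integral_neg_eq_self
      (fun t => Real.exp (-(2 * √β) * Real.cosh t) * Real.exp (ν * t)) volume
    have hadd := integral_add hint' hint'.comp_neg
    rw [hneg] at hadd
    have hcosh (t : ℝ) : Real.exp (-(2 * √β) * Real.cosh |t|) * Real.cosh (ν * |t|) =
        2⁻¹ * (Real.exp (-(2 * √β) * Real.cosh t) * Real.exp (ν * t) +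
          Real.exp (-(2 * √β) * Real.cosh (-t)) * Real.exp (ν * -t)) := by
      have : Real.cosh (ν * |t|) = Real.cosh (ν * t) := by
        rcases abs_choice t with h | h <;> rw [h]
        rw [mul_neg, Real.cosh_neg]
      rw [Real.cosh_abs, this, Real.cosh_neg, Real.cosh_eq (ν * t), mul_neg]
      ring
    simp_rw [hcosh]
    rw [integral_const_mul, hadd]
    ring
  rw [hsub, heven, integral_comp_abs
    (f := fun t => Real.exp (-(2 * √β) * Real.cosh t) * Real.cosh (ν * t)), besselK]
  ring

lemma integral_besselKernel_nonneg (ν β : ℝ) : 0 ≤ ∫ x in Set.Ioi 0, besselKernel ν β x :=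
  setIntegral_nonneg measurableSet_Ioi fun _ hx => besselKernel_nonneg ν β hx

lemma integral_besselKernel_anti (ν : ℝ) {β β' : ℝ} (hβ : 0 < β) (h : β ≤ β') :
    ∫ x in Set.Ioi 0, besselKernel ν β' x ≤ ∫ x in Set.Ioi 0, besselKernel ν β x := by
  refine setIntegral_mono_on (integrableOn_besselKernel ν (hβ.trans_le h))
    (integrableOn_besselKernel ν hβ) measurableSet_Ioi fun x (hx : 0 < x) => ?_
  unfold besselKernel
  gcongr

/-- The function of the interference power that is averaged in one term of the outage
probability. It is extended to the negative half-line by its value at `0`, which keeps it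
bounded. -/
def condTerm (A c : ℝ) (k m : ℕ) (u : ℝ) : ℝ :=
  (max u 0 + 1) ^ m * Real.exp (-(A * max u 0)) *
    ∫ x in Set.Ioi 0, besselKernel ((k : ℝ) - m + 1) (c * (max u 0 + 1)) x

lemma condTerm_nonneg (A c : ℝ) (k m : ℕ) (u : ℝ) : 0 ≤ condTerm A c k m u :=
  mul_nonneg (by positivity) (integral_besselKernel_nonneg _ _)

lemma measurable_condTerm (A c : ℝ) (k m : ℕ) : Measurable (condTerm A c k m) := by
  have h : Measurable fun u : ℝ =>
      ∫ x in Set.Ioi 0, besselKernel ((k : ℝ) - m + 1) (c * (max u 0 + 1)) x := by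
    refine StronglyMeasurable.measurable (StronglyMeasurable.integral_prod_right (f := fun u x =>
      besselKernel ((k : ℝ) - m + 1) (c * (max u 0 + 1)) x) ?_)
    refine Measurable.stronglyMeasurable ?_
    exact (measurable_besselKernel _).comp
      (f := fun p : ℝ × ℝ => (c * (max p.1 0 + 1), p.2)) (by fun_prop)
  unfold condTerm
  fun_prop

lemma exists_condTerm_le {A c : ℝ} (hA : 0 < A) (hc : 0 < c) (k m : ℕ) :
    ∃ C, ∀ u, |condTerm A c k m u| ≤ C := by
  refine ⟨m ! / A ^ m * Real.exp A *
    ∫ x in Set.Ioi 0, besselKernel ((k : ℝ) - m + 1) c x, fun u => ?_⟩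
  rw [abs_of_nonneg (condTerm_nonneg A c k m u), condTerm]
  have hw : 0 ≤ max u 0 := le_max_right u 0
  generalize max u 0 = w at hw ⊢
  refine mul_le_mul ?_ (integral_besselKernel_anti _ hc (by nlinarith))
    (integral_besselKernel_nonneg _ _) (by positivity)
  have h1 := Real.pow_div_factorial_le_exp (A * (w + 1)) (by positivity) m
  rw [mul_pow, mul_add, mul_one, Real.exp_add, div_le_iff₀ (by positivity)] at h1
  rw [Real.exp_neg, ← div_eq_mul_inv, div_le_iff₀ (Real.exp_pos _)]
  have h2 : 0 < A ^ m := by positivity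
  rw [div_mul_eq_mul_div, div_mul_eq_mul_div, le_div_iff₀ h2]
  linarith

/-- On the half-line, a Gamma density times the averaged function is a multiple of the integrand
of the outage formula. -/
lemma pow_mul_exp_mul_condTerm {ρ₁ ρ₂ γ r : ℝ} (hc : 0 < (γ + 1) * γ / (ρ₁ * ρ₂)) (k m q : ℕ)
    {x : ℝ} (hx : 0 < x) :
    x ^ q * Real.exp (-(1 / r * x)) * condTerm (γ / ρ₁) ((γ + 1) * γ / (ρ₁ * ρ₂)) k m x =
      2 * ((γ + 1) * γ / (ρ₁ * ρ₂)) ^ (((k : ℝ) - m + 1) / 2) *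
        outageIntegrand ρ₁ ρ₂ γ r k m q x := by
  have hx1 : 0 < x + 1 := by positivity
  rw [condTerm, max_eq_left hx.le, integral_besselKernel _ (mul_pos hc hx1), outageIntegrand,
    Real.mul_rpow hc.le hx1.le]
  have h1 : (x + 1) ^ (((k : ℝ) + m + 1) / 2) =
      (x + 1) ^ (((k : ℝ) - m + 1) / 2) * (x + 1) ^ m := by
    rw [← Real.rpow_natCast, ← Real.rpow_add hx1]
    ring_nf
  have h2 : Real.exp (-(γ / ρ₁ + 1 / r) * x) =
      Real.exp (-(1 / r * x)) * Real.exp (-(γ / ρ₁ * x)) := by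
    rw [← Real.exp_add]
    ring_nf
  rw [h1, h2]
  ring

lemma integrableOn_outageIntegrand {ρ₁ ρ₂ γ r : ℝ} (hρ₁ : 0 < ρ₁) (hρ₂ : 0 < ρ₂) (hγ : 0 < γ)
    (hr : 0 < r) (k m q : ℕ) : IntegrableOn (outageIntegrand ρ₁ ρ₂ γ r k m q) (Set.Ioi 0) := by
  have hc : 0 < (γ + 1) * γ / (ρ₁ * ρ₂) := by positivity
  have hK : 2 * ((γ + 1) * γ / (ρ₁ * ρ₂)) ^ (((k : ℝ) - m + 1) / 2) ≠ 0 :=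
    mul_ne_zero two_ne_zero (Real.rpow_pos_of_pos hc _).ne'
  obtain ⟨C, hC⟩ := exists_condTerm_le (div_pos hγ hρ₁) hc k m
  have h := (integrableOn_pow_mul_exp_neg q (one_div_pos.2 hr)).mul_bdd
    (measurable_condTerm (γ / ρ₁) ((γ + 1) * γ / (ρ₁ * ρ₂)) k m).aestronglyMeasurable
    (.of_forall hC)
  have h2 := (integrableOn_congr_fun
    (fun x hx => pow_mul_exp_mul_condTerm hc k m q hx) measurableSet_Ioi).1 h
  exact (integrable_const_mul_iff hK.isUnit _).1 h2

/-- Averaging over the interference power produces the integral of the outage formula. -/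
lemma integral_condTerm {M : ℕ} (hM : 1 ≤ M) {ρ₁ ρ₂ γ : ℝ} (hρ₁ : 0 < ρ₁) (hρ₂ : 0 < ρ₂)
    (hγ : 0 < γ) {a : Fin M → ℝ} (ha : ∀ i, 0 < a i) (k m : ℕ) :
    ∫ u, condTerm (γ / ρ₁) ((γ + 1) * γ / (ρ₁ * ρ₂)) k m u ∂(interferenceLaw a) =
      2 * ((γ + 1) * γ / (ρ₁ * ρ₂)) ^ (((k : ℝ) - m + 1) / 2) *
        outageIntegral ρ₁ ρ₂ a γ k m := by
  have hc : 0 < (γ + 1) * γ / (ρ₁ * ρ₂) := by positivity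
  obtain ⟨C, hC⟩ := exists_condTerm_le (div_pos hγ hρ₁) hc k m
  rw [integral_interferenceLaw hM ha (measurable_condTerm _ _ k m) hC, outageIntegral,
    Finset.mul_sum]
  refine Finset.sum_congr rfl fun p _ => ?_
  rw [Finset.mul_sum]
  refine Finset.sum_congr rfl fun q _ => ?_
  rw [setIntegral_congr_fun measurableSet_Ioi
    fun x hx => pow_mul_exp_mul_condTerm (r := distinctVal a p) hc k m q hx, integral_const_mul]
  ring

/-! ### The success probability for a given interference power -/

/-- The probability that the link succeeds, given the interference power `u`. Here `A = γ / ρ₁`,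
`τ = γ / ρ₂`, `b = 1 / ρ₂`, and `n + 1` is the number of antennas. -/
def condSuccess (n : ℕ) (A τ b u : ℝ) : ℝ :=
  Real.exp (-A - τ) / n ! * ∑ m ∈ Finset.range (n + 1), A ^ m * (1 / (m ! : ℝ)) *
    ∑ j ∈ Finset.range (m + 1), (m.choose j : ℝ) * b ^ (m - j) *
      ∑ k ∈ Finset.range (n + j + 1), ((n + j).choose k : ℝ) * τ ^ (n + j - k) *
        condTerm A (A * (τ + b)) k m u

lemma condSuccess_nonneg (n : ℕ) {A τ b : ℝ} (hA : 0 ≤ A) (hτ : 0 ≤ τ) (hb : 0 ≤ b) (u : ℝ) :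
    0 ≤ condSuccess n A τ b u := by
  refine mul_nonneg (by positivity) (Finset.sum_nonneg fun m _ => mul_nonneg (by positivity)
    (Finset.sum_nonneg fun j _ => mul_nonneg (by positivity)
      (Finset.sum_nonneg fun k _ => mul_nonneg (by positivity) (condTerm_nonneg _ _ _ _ _))))

/-- Binomial expansion of the Erlang density times the Poisson sum into Bessel kernels. -/
lemma erlangPDF_mul_tail (n : ℕ) {A τ b u s : ℝ} (hs : 0 < s) :
    erlangPDF n (s + τ) * (Real.exp (-(A * (u + 1) * (s + τ + b) / s)) *
        ∑ m ∈ Finset.range (n + 1), (A * (u + 1) * (s + τ + b) / s) ^ m * (1 / (m ! : ℝ))) =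
      Real.exp (-A - τ) / n ! * ∑ m ∈ Finset.range (n + 1), A ^ m * (1 / (m ! : ℝ)) *
        ∑ j ∈ Finset.range (m + 1), (m.choose j : ℝ) * b ^ (m - j) *
          ∑ k ∈ Finset.range (n + j + 1), ((n + j).choose k : ℝ) * τ ^ (n + j - k) *
            ((u + 1) ^ m * Real.exp (-(A * u)) *
              besselKernel ((k : ℝ) - m + 1) (A * (τ + b) * (u + 1)) s) := by
  have hker (k m : ℕ) : besselKernel ((k : ℝ) - m + 1) (A * (τ + b) * (u + 1)) s =
      s ^ k / s ^ m * Real.exp (-s - A * (τ + b) * (u + 1) / s) := by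
    rw [besselKernel, add_sub_cancel_right, Real.rpow_sub hs, Real.rpow_natCast, Real.rpow_natCast]
  have hexp : Real.exp (-(s + τ)) * Real.exp (-(A * (u + 1) * (s + τ + b) / s)) =
      Real.exp (-A - τ) * (Real.exp (-(A * u)) *
        Real.exp (-s - A * (τ + b) * (u + 1) / s)) := by
    rw [← Real.exp_add, ← Real.exp_add, ← Real.exp_add]
    congr 1
    field_simp
    ring
  have hpow (m : ℕ) : (s + τ) ^ n * (A * (u + 1) * (s + τ + b) / s) ^ m =
      A ^ m * ∑ j ∈ Finset.range (m + 1), (m.choose j : ℝ) * b ^ (m - j) *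
        ∑ k ∈ Finset.range (n + j + 1), ((n + j).choose k : ℝ) * τ ^ (n + j - k) *
          ((u + 1) ^ m * (s ^ k / s ^ m)) := by
    have h1 (j : ℕ) : ∑ k ∈ Finset.range (n + j + 1), ((n + j).choose k : ℝ) * τ ^ (n + j - k) *
        ((u + 1) ^ m * (s ^ k / s ^ m)) = (s + τ) ^ (n + j) * ((u + 1) ^ m / s ^ m) := by
      rw [add_pow s τ, Finset.sum_mul]
      exact Finset.sum_congr rfl fun k _ => by ring
    have h2 : ∑ j ∈ Finset.range (m + 1), (m.choose j : ℝ) * b ^ (m - j) *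
        ((s + τ) ^ (n + j) * ((u + 1) ^ m / s ^ m)) =
        (s + τ + b) ^ m * ((s + τ) ^ n * ((u + 1) ^ m / s ^ m)) := by
      rw [add_pow (s + τ) b, Finset.sum_mul]
      exact Finset.sum_congr rfl fun j _ => by rw [pow_add]; ring
    simp_rw [h1]
    rw [h2, div_pow, mul_pow, mul_pow]
    ring
  calc erlangPDF n (s + τ) * (Real.exp (-(A * (u + 1) * (s + τ + b) / s)) *
        ∑ m ∈ Finset.range (n + 1), (A * (u + 1) * (s + τ + b) / s) ^ m * (1 / (m ! : ℝ)))
      = (Real.exp (-(s + τ)) * Real.exp (-(A * (u + 1) * (s + τ + b) / s))) / n ! *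
          ∑ m ∈ Finset.range (n + 1),
            ((s + τ) ^ n * (A * (u + 1) * (s + τ + b) / s) ^ m) * (1 / (m ! : ℝ)) := by
        rw [erlangPDF]
        simp_rw [mul_assoc ((s + τ) ^ n)]
        rw [← Finset.mul_sum]
        ring
    _ = _ := by
        rw [hexp, mul_div_right_comm, mul_assoc]
        congr 1
        rw [Finset.mul_sum]
        refine Finset.sum_congr rfl fun m _ => ?_
        rw [hpow]
        simp_rw [hker, Finset.mul_sum, Finset.sum_mul, Finset.mul_sum]
        exact Finset.sum_congr rfl fun j _ => Finset.sum_congr rfl fun k _ => by ring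

/-- Averaging the Erlang tail of the first hop over the Erlang law of the second hop. -/
lemma lintegral_erlang_tail (n : ℕ) {A τ b u : ℝ} (hA : 0 < A) (hτ : 0 < τ) (hb : 0 < b)
    (hu : 0 ≤ u) :
    ∫⁻ x, (Set.Ioi τ).indicator
        (fun x => erlang n (Set.Ici (A * (u + 1) * (x + b) / (x - τ)))) x ∂(erlang n) =
      ENNReal.ofReal (condSuccess n A τ b u) := by
  have hu1 : 0 < u + 1 := by linarith
  have hβ : 0 < A * (τ + b) * (u + 1) := by positivity
  let E : ℝ → ℝ := fun s =>
    Real.exp (-A - τ) / n ! * ∑ m ∈ Finset.range (n + 1), A ^ m * (1 / (m ! : ℝ)) *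
      ∑ j ∈ Finset.range (m + 1), (m.choose j : ℝ) * b ^ (m - j) *
        ∑ k ∈ Finset.range (n + j + 1), ((n + j).choose k : ℝ) * τ ^ (n + j - k) *
          ((u + 1) ^ m * Real.exp (-(A * u)) *
            besselKernel ((k : ℝ) - m + 1) (A * (τ + b) * (u + 1)) s)
  -- shift of the half-line `(τ, ∞)` to the origin
  have hshift (G : ℝ → ENNReal) : ∫⁻ x in Set.Ioi 0, (Set.Ioi τ).indicator G x =
      ∫⁻ s in Set.Ioi 0, G (s + τ) := by
    rw [setLIntegral_indicator measurableSet_Ioi, Set.Ioi_inter_Ioi, sup_of_le_left hτ.le,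
      ← lintegral_indicator measurableSet_Ioi, ← lintegral_indicator measurableSet_Ioi,
      ← lintegral_add_right_eq_self _ τ]
    refine lintegral_congr fun s => ?_
    simp only [Set.indicator, Set.mem_Ioi, lt_add_iff_pos_left]
  have hdens (G : ℝ → ENNReal) : ∫⁻ x, (Set.Ioi τ).indicator G x ∂(erlang n) =
      ∫⁻ s in Set.Ioi 0, ENNReal.ofReal (erlangPDF n (s + τ)) * G (s + τ) := by
    rw [erlang, lintegral_withDensity_eq_lintegral_mul_non_measurable _
      (measurable_erlangPDF n).ennreal_ofReal (.of_forall fun _ => ENNReal.ofReal_lt_top),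
      ← hshift fun x => ENNReal.ofReal (erlangPDF n x) * G x]
    refine lintegral_congr fun x => ?_
    by_cases hx : x ∈ Set.Ioi τ <;> simp [hx]
  have h1 : ∫⁻ x, (Set.Ioi τ).indicator
        (fun x => erlang n (Set.Ici (A * (u + 1) * (x + b) / (x - τ)))) x ∂(erlang n) =
      ∫⁻ s in Set.Ioi 0, ENNReal.ofReal (E s) := by
    rw [hdens]
    refine setLIntegral_congr_fun measurableSet_Ioi fun s (hs : 0 < s) => ?_
    simp only [add_sub_cancel_right]
    rw [erlang_Ici n (by positivity), ← ENNReal.ofReal_mul (by unfold erlangPDF; positivity),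
      erlangPDF_mul_tail n hs]
  rw [h1, ← ofReal_integral_eq_lintegral_ofReal]
  · have hi (k m : ℕ) :=
      (integrableOn_besselKernel ((k : ℝ) - m + 1) hβ).const_mul
        ((u + 1) ^ m * Real.exp (-(A * u)))
    congr 1
    rw [condSuccess, integral_const_mul, integral_finsetSum _ fun m _ =>
      (integrable_finsetSum _ fun j _ => (integrable_finsetSum _ fun k _ =>
        (hi k m).const_mul _).const_mul _).const_mul _]
    congr 1
    refine Finset.sum_congr rfl fun m _ => ?_
    rw [integral_const_mul, integral_finsetSum _ fun j _ => (integrable_finsetSum _ fun k _ =>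
        (hi k m).const_mul _).const_mul _]
    congr 1
    refine Finset.sum_congr rfl fun j _ => ?_
    rw [integral_const_mul, integral_finsetSum _ fun k _ => (hi k m).const_mul _]
    congr 1
    refine Finset.sum_congr rfl fun k _ => ?_
    rw [integral_const_mul, integral_const_mul, condTerm, max_eq_left hu]
  · exact (integrable_finsetSum _ fun m _ => (integrable_finsetSum _ fun j _ =>
      (integrable_finsetSum _ fun k _ => ((integrableOn_besselKernel _ hβ).const_mul
        _).const_mul _).const_mul _).const_mul _).const_mul _
  · refine (ae_restrict_mem measurableSet_Ioi).mono fun s (hs : 0 < s) => ?_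
    exact mul_nonneg (by positivity) (Finset.sum_nonneg fun m _ => mul_nonneg (by positivity)
      (Finset.sum_nonneg fun j _ => mul_nonneg (by positivity)
        (Finset.sum_nonneg fun k _ => mul_nonneg (by positivity)
          (mul_nonneg (by positivity) (besselKernel_nonneg _ _ hs)))))

lemma integrable_condTerm {A τ b : ℝ} (hA : 0 < A) (hτ : 0 < τ) (hb : 0 < b)
    {ν : Measure ℝ} [IsFiniteMeasure ν] (k m : ℕ) :
    Integrable (condTerm A (A * (τ + b)) k m) ν := by
  obtain ⟨C, hC⟩ := exists_condTerm_le hA (mul_pos hA (add_pos hτ hb)) k m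
  exact .of_bound (measurable_condTerm _ _ _ _).aestronglyMeasurable C (.of_forall hC)

/-! ### Reduction of the link to three independent scalars -/

section Link

/-- The interference power at the output of the receive combiner, relative to the noise power. -/
def combinedInterference {N M : ℕ} (ρI : Fin M → ℝ) (h₁ : Fin N → ℂ) (hI : Fin M → Fin N → ℂ) : ℝ :=
  (∑ i, ‖star h₁ ⬝ᵥ hI i‖ ^ 2 * ρI i) / sqNorm h₁

lemma sqNorm_nonneg {N : ℕ} (v : Fin N → ℂ) : 0 ≤ sqNorm v :=
  Finset.sum_nonneg fun _ _ => by positivity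

lemma combinedInterference_nonneg {N M : ℕ} {ρI : Fin M → ℝ} (hρI : ∀ i, 0 < ρI i)
    (h₁ : Fin N → ℂ) (hI : Fin M → Fin N → ℂ) : 0 ≤ combinedInterference ρI h₁ hI :=
  div_nonneg (Finset.sum_nonneg fun i _ => mul_nonneg (by positivity) (hρI i).le)
    (sqNorm_nonneg _)

lemma measurable_combinedInterference {N M : ℕ} (ρI : Fin M → ℝ) :
    Measurable fun p : (Fin N → ℂ) × (Fin M → Fin N → ℂ) =>
      combinedInterference ρI p.1 p.2 := by
  unfold combinedInterference sqNorm dotProduct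
  simp only [Pi.star_apply]
  fun_prop

lemma star_dotProduct_self {N : ℕ} (v : Fin N → ℂ) : star v ⬝ᵥ v = (sqNorm v : ℂ) := by
  simp only [dotProduct, sqNorm, Pi.star_apply, Complex.ofReal_sum]
  refine Finset.sum_congr rfl fun i _ => ?_
  rw [Complex.ofReal_pow]
  exact Complex.conj_mul' (v i)

/-- The SINR of the MRC/MRT scheme as a function of the two channel gains and of the combined
interference power. -/
lemma sinrMRC_eq {N M : ℕ} {Ps Pr N₀ : ℝ} (hPs : 0 < Ps) (hPr : 0 < Pr) (hN₀ : 0 < N₀)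
    {PI : Fin M → ℝ} (hPI : ∀ i, 0 < PI i) {h₁ : Fin N → ℂ} (hI : Fin M → Fin N → ℂ)
    (h₂ : Fin N → ℂ) (hpos : 0 < sqNorm h₁) :
    sinrMRC Ps Pr N₀ PI h₁ hI h₂ =
      Pr / N₀ * sqNorm h₂ * (sqNorm h₁ * (Ps / N₀)) /
        (Pr / N₀ * sqNorm h₂ * (combinedInterference (fun i => PI i / N₀) h₁ hI + 1) +
          sqNorm h₁ * (Ps / N₀) + combinedInterference (fun i => PI i / N₀) h₁ hI + 1) := by
  have hU := combinedInterference_nonneg (fun i => div_pos (hPI i) hN₀) h₁ hI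
  set U := combinedInterference (fun i => PI i / N₀) h₁ hI with hUdef
  have hx := sqNorm_nonneg h₂
  have hsum : (∑ i, ‖star h₁ ⬝ᵥ hI i‖ ^ 2 * PI i) = U * N₀ * sqNorm h₁ := by
    rw [hUdef, combinedInterference]
    simp_rw [← mul_div_assoc]
    rw [← Finset.sum_div]
    field_simp
  have hgain : mrcGainSq Ps Pr N₀ PI h₁ hI = Pr / (sqNorm h₁ * Ps + U * N₀ + N₀) := by
    rw [mrcGainSq, hsum, mul_div_cancel_right₀ _ hpos.ne']
  set g := mrcGainSq Ps Pr N₀ PI h₁ hI with hg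
  have hg0 : 0 ≤ g := by rw [hgain]; positivity
  -- the transmit beam has gain `‖h₂‖`
  have hbeam : h₂ ⬝ᵥ (fun n => star (h₂ n) / ((√(sqNorm h₂) : ℝ) : ℂ)) =
      ((√(sqNorm h₂) : ℝ) : ℂ) := by
    have : h₂ ⬝ᵥ (fun n => star (h₂ n) / ((√(sqNorm h₂) : ℝ) : ℂ)) =
        (star h₂ ⬝ᵥ h₂) / ((√(sqNorm h₂) : ℝ) : ℂ) := by
      simp only [dotProduct, Finset.sum_div, Pi.star_apply]
      exact Finset.sum_congr rfl fun i _ => by ring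
    rw [this, star_dotProduct_self, ← Complex.ofReal_div, Real.div_sqrt]
  have hcomb (w : Fin N → ℂ) : (fun n => star (h₁ n) / ((√(sqNorm h₁) : ℝ) : ℂ)) ⬝ᵥ w =
      (star h₁ ⬝ᵥ w) / ((√(sqNorm h₁) : ℝ) : ℂ) := by
    simp only [dotProduct, Finset.sum_div, Pi.star_apply]
    exact Finset.sum_congr rfl fun i _ => by ring
  have hrow : h₂ ᵥ* mrcPrecoder Ps Pr N₀ PI h₁ hI h₂ =
      (((√g : ℝ) : ℂ) * ((√(sqNorm h₂) : ℝ) : ℂ)) •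
        (fun n => star (h₁ n) / ((√(sqNorm h₁) : ℝ) : ℂ)) := by
    rw [mrcPrecoder, vecMul_smul, vecMul_vecMulVec, hbeam, smul_smul]
  have hsq (w : Fin N → ℂ) : ‖h₂ ⬝ᵥ (mrcPrecoder Ps Pr N₀ PI h₁ hI h₂ *ᵥ w)‖ ^ 2 =
      g * sqNorm h₂ * (‖star h₁ ⬝ᵥ w‖ ^ 2 / sqNorm h₁) := by
    rw [dotProduct_mulVec, hrow, smul_dotProduct, hcomb, norm_smul, norm_mul, norm_div,
      Complex.norm_real, Complex.norm_real, Complex.norm_real, mul_pow, mul_pow, div_pow]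
    simp only [Real.norm_eq_abs, sq_abs, Real.sq_sqrt hg0, Real.sq_sqrt hx,
      Real.sq_sqrt hpos.le]
  have hnoise : sqNorm (h₂ ᵥ* mrcPrecoder Ps Pr N₀ PI h₁ hI h₂) = g * sqNorm h₂ := by
    rw [hrow]
    have (i : Fin N) : ‖((((√g : ℝ) : ℂ) * ((√(sqNorm h₂) : ℝ) : ℂ)) •
        (fun n => star (h₁ n) / ((√(sqNorm h₁) : ℝ) : ℂ))) i‖ ^ 2 =
        g * sqNorm h₂ / sqNorm h₁ * ‖h₁ i‖ ^ 2 := by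
      rw [Pi.smul_apply, norm_smul, norm_mul, norm_div, norm_star,
        Complex.norm_real, Complex.norm_real, Complex.norm_real, mul_pow, mul_pow, div_pow]
      simp only [Real.norm_eq_abs, sq_abs, Real.sq_sqrt hg0, Real.sq_sqrt hx,
        Real.sq_sqrt hpos.le]
      ring
    rw [sqNorm]
    simp_rw [this]
    rw [← Finset.mul_sum, ← sqNorm, div_mul_cancel₀ _ hpos.ne']
  have hinterf : ∑ i, ‖h₂ ⬝ᵥ (mrcPrecoder Ps Pr N₀ PI h₁ hI h₂ *ᵥ hI i)‖ ^ 2 * PI i =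
      g * sqNorm h₂ * (U * N₀) := by
    simp_rw [hsq]
    have : ∑ i, g * sqNorm h₂ * (‖star h₁ ⬝ᵥ hI i‖ ^ 2 / sqNorm h₁) * PI i =
        g * sqNorm h₂ / sqNorm h₁ * ∑ i, ‖star h₁ ⬝ᵥ hI i‖ ^ 2 * PI i := by
      rw [Finset.mul_sum]
      exact Finset.sum_congr rfl fun i _ => by ring
    rw [this, hsum]
    field_simp
  rw [sinrMRC, sinr, hsq, hinterf, hnoise, star_dotProduct_self, Complex.norm_real,
    Real.norm_of_nonneg hpos.le, hgain]
  have hd : 0 < sqNorm h₁ * Ps + U * N₀ + N₀ := by positivity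
  generalize sqNorm h₁ = α at *
  generalize sqNorm h₂ = x at *
  clear_value U
  have hd1 : Pr / (α * Ps + U * N₀ + N₀) * x * (U * N₀) + Pr / (α * Ps + U * N₀ + N₀) * x * N₀ +
      N₀ ≠ 0 := by positivity
  have hd2 : Pr / N₀ * x * (U + 1) + α * (Ps / N₀) + U + 1 ≠ 0 := by positivity
  rw [div_eq_div_iff hd1 hd2]
  field_simp
  ring

/-- The success event with the denominator of the SINR cleared and the terms in `α` collected. -/
lemma le_sinr_iff {ρ₁ ρ₂ t α u x : ℝ} (hρ₁ : 0 < ρ₁) (hρ₂ : 0 < ρ₂) (hα : 0 ≤ α) (hu : 0 ≤ u)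
    (hx : 0 ≤ x) :
    t ≤ ρ₂ * x * (α * ρ₁) / (ρ₂ * x * (u + 1) + α * ρ₁ + u + 1) ↔
      t * (u + 1) * (ρ₂ * x + 1) ≤ α * ρ₁ * (ρ₂ * x - t) := by
  rw [le_div_iff₀ (by positivity)]
  constructor <;> intro h <;> nlinarith

variable {N M : ℕ}

/-- The law of the channels: three independent blocks of independent standard complex Gaussian
entries. -/
def channelLaw (N M : ℕ) : Measure ((Fin N → ℂ) × (Fin M → Fin N → ℂ) × (Fin N → ℂ)) :=
  (Measure.pi fun _ => stdComplexGaussian).prod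
    ((Measure.pi fun _ => Measure.pi fun _ => stdComplexGaussian).prod
      (Measure.pi fun _ => stdComplexGaussian))

lemma map_channels {Ω : Type*} [MeasurableSpace Ω] {μ : Measure Ω}
    {h₁ : Ω → Fin N → ℂ} {hI : Ω → Fin M → Fin N → ℂ} {h₂ : Ω → Fin N → ℂ}
    (hlaw : ∀ s, HasLaw (channelEntries h₁ hI h₂ s) stdComplexGaussian μ)
    (hindep : iIndepFun (channelEntries h₁ hI h₂) μ) :
    AEMeasurable (fun ω => (h₁ ω, hI ω, h₂ ω)) μ ∧
      μ.map (fun ω => (h₁ ω, hI ω, h₂ ω)) = channelLaw N M := by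
  have : IsProbabilityMeasure μ := hindep.isProbabilityMeasure
  let join (p : (Fin N → ℂ) × (Fin M → Fin N → ℂ) × (Fin N → ℂ)) :
      Fin N ⊕ (Fin M × Fin N) ⊕ Fin N → ℂ :=
    Sum.elim p.1 (Sum.elim (fun ik => p.2.1 ik.1 ik.2) p.2.2)
  let split (f : Fin N ⊕ (Fin M × Fin N) ⊕ Fin N → ℂ) :
      (Fin N → ℂ) × (Fin M → Fin N → ℂ) × (Fin N → ℂ) :=
    (fun n => f (.inl n), fun i n => f (.inr (.inl (i, n))), fun n => f (.inr (.inr n)))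
  have hjoin : Measurable join := by
    refine measurable_pi_lambda _ fun s => ?_
    rcases s with n | ⟨i, n⟩ | n <;> simp only [join, Sum.elim_inl, Sum.elim_inr] <;> fun_prop
  have hsplit : Measurable split := by fun_prop
  have hpi : (channelLaw N M).map join = Measure.pi fun _ => stdComplexGaussian := by
    refine (Measure.pi_eq fun s hs => ?_).symm
    have hset : join ⁻¹' Set.univ.pi s = (Set.univ.pi fun n => s (.inl n)) ×ˢ
        ((Set.univ.pi fun i => Set.univ.pi fun n => s (.inr (.inl (i, n)))) ×ˢ
          (Set.univ.pi fun n => s (.inr (.inr n)))) := by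
      ext p
      simp [join, Set.mem_pi, Sum.forall]
    rw [Measure.map_apply hjoin (MeasurableSet.univ_pi hs), hset, channelLaw, Measure.prod_prod,
      Measure.prod_prod, Measure.pi_pi, Measure.pi_pi, Measure.pi_pi, Fintype.prod_sum_type,
      Fintype.prod_sum_type, Fintype.prod_prod_type]
    simp only [Measure.pi_pi]
  have hX : AEMeasurable (fun ω s => channelEntries h₁ hI h₂ s ω) μ :=
    aemeasurable_pi_lambda _ fun s => (hlaw s).aemeasurable
  have hcomp : (fun ω => (h₁ ω, hI ω, h₂ ω)) =
      split ∘ fun ω s => channelEntries h₁ hI h₂ s ω := rfl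
  refine ⟨hcomp ▸ hsplit.comp_aemeasurable hX, ?_⟩
  rw [hcomp, ← AEMeasurable.map_map_of_aemeasurable hsplit.aemeasurable hX,
    (iIndepFun_iff_map_fun_eq_pi_map fun s => (hlaw s).aemeasurable).1 hindep]
  simp_rw [(hlaw _).map_eq]
  rw [← hpi, Measure.map_map hsplit hjoin]
  exact Measure.map_id

/-- For a fixed first-hop channel, isotropy makes the combined interference independent of that
channel. -/
lemma map_combinedInterference (ρI : Fin M → ℝ) {h₁ : Fin N → ℂ} (hpos : 0 < sqNorm h₁) :
    (Measure.pi fun _ : Fin M => Measure.pi fun _ : Fin N => stdComplexGaussian).map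
      (combinedInterference ρI h₁) = interferenceLaw ρI := by
  let v : Fin N → ℂ := fun n => star (h₁ n) / ((√(sqNorm h₁) : ℝ) : ℂ)
  have hv : ∑ n, ‖v n‖ ^ 2 = 1 := by
    have (n : Fin N) : ‖v n‖ ^ 2 = ‖h₁ n‖ ^ 2 / sqNorm h₁ := by
      simp only [v]
      rw [norm_div, norm_star, Complex.norm_real, div_pow, Real.norm_eq_abs, sq_abs,
        Real.sq_sqrt hpos.le]
    simp_rw [this]
    rw [← Finset.sum_div, ← sqNorm, div_self hpos.ne']
  have hfac : combinedInterference ρI h₁ =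
      (fun z : Fin M → ℂ => ∑ i, ‖z i‖ ^ 2 * ρI i) ∘ fun B i => v ⬝ᵥ B i := by
    funext B
    simp only [Function.comp_apply, combinedInterference, Finset.sum_div]
    refine Finset.sum_congr rfl fun i _ => ?_
    have : v ⬝ᵥ B i = (star h₁ ⬝ᵥ B i) / ((√(sqNorm h₁) : ℝ) : ℂ) := by
      simp only [v, dotProduct, Finset.sum_div, Pi.star_apply]
      exact Finset.sum_congr rfl fun i _ => by ring
    rw [this, norm_div, Complex.norm_real, div_pow, Real.norm_eq_abs, sq_abs,
      Real.sq_sqrt hpos.le]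
    ring
  have hvm : Measurable fun z : Fin N → ℂ => v ⬝ᵥ z := by unfold dotProduct; fun_prop
  have hdm : Measurable fun (B : Fin M → Fin N → ℂ) i => v ⬝ᵥ B i := by
    unfold dotProduct; fun_prop
  have hdot := map_dotProduct_pi_stdComplexGaussian hv
  have : ∀ _ : Fin M, IsProbabilityMeasure
      ((Measure.pi fun _ : Fin N => stdComplexGaussian).map fun z => v ⬝ᵥ z) := fun _ => by
    rw [hdot]; infer_instance
  rw [hfac, ← Measure.map_map (measurable_weighted_sum ρI) hdm,
    Measure.pi_map_pi fun _ => hvm.aemeasurable, hdot, interferenceLaw]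

/-- If the law of `U a`, for fixed `a`, does not depend on `a`, then `U` is independent of the
functions of `a` and of the functions of any further independent variable. -/
lemma measurePreserving_triple {α β δ : Type*} [MeasurableSpace α] [MeasurableSpace β]
    [MeasurableSpace δ] {μa : Measure α} {μb : Measure β} {μd : Measure δ}
    [SFinite μa] [SFinite μb] [SFinite μd] {νa νb νd : Measure ℝ} [SFinite νb] [SFinite νd]
    {f : α → ℝ} {U : α → β → ℝ} {g : δ → ℝ} (hf : MeasurePreserving f μa νa)
    (hUm : Measurable fun p : α × β => U p.1 p.2) (hU : ∀ᵐ a ∂μa, μb.map (U a) = νb)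
    (hg : MeasurePreserving g μd νd) :
    MeasurePreserving (fun p : α × β × δ => (f p.1, U p.1 p.2.1, g p.2.2))
      (μa.prod (μb.prod μd)) (νa.prod (νb.prod νd)) := by
  have hgm : Measurable (Function.uncurry fun (a : α) (p : β × δ) => (U a p.1, g p.2)) := by
    have h1 : Measurable fun q : α × β × δ => (q.1, q.2.1) := by fun_prop
    have h2 : Measurable fun q : α × β × δ => q.2.2 := by fun_prop
    exact (hUm.comp h1).prodMk (hg.measurable.comp h2)
  refine hf.skew_product hgm (hU.mono fun a ha => ?_)
  have hUa : MeasurePreserving (U a) μb νb := ⟨hUm.comp measurable_prodMk_left, ha⟩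
  exact (hUa.prod hg).map_eq

/-- The first-hop gain, the combined interference power and the second-hop gain. -/
def gains (ρI : Fin M → ℝ) (p : (Fin N → ℂ) × (Fin M → Fin N → ℂ) × (Fin N → ℂ)) : ℝ × ℝ × ℝ :=
  (sqNorm p.1, combinedInterference ρI p.1 p.2.1, sqNorm p.2.2)

/-- The two channel gains and the combined interference power are independent. -/
lemma measurePreserving_gains (n : ℕ) (ρI : Fin M → ℝ) :
    MeasurePreserving (gains ρI) (channelLaw (n + 1) M)
      ((erlang n).prod ((interferenceLaw ρI).prod (erlang n))) := by
  have hs : MeasurePreserving sqNorm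
      (Measure.pi fun _ : Fin (n + 1) => stdComplexGaussian) (erlang n) :=
    ⟨measurable_sqNorm _, map_sqNorm n⟩
  exact measurePreserving_triple hs (measurable_combinedInterference ρI)
    ((hs.quasiMeasurePreserving.ae (erlang_pos n)).mono fun _ h => map_combinedInterference ρI h) hs

/-- The success event in terms of the first-hop gain, the interference power and the second-hop
gain. -/
def successSet (ρ₁ ρ₂ t : ℝ) : Set (ℝ × ℝ × ℝ) :=
  {p | t * (p.2.1 + 1) * (ρ₂ * p.2.2 + 1) ≤ p.1 * ρ₁ * (ρ₂ * p.2.2 - t)}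

lemma measurableSet_successSet (ρ₁ ρ₂ t : ℝ) : MeasurableSet (successSet ρ₁ ρ₂ t) :=
  measurableSet_le (by fun_prop) (by fun_prop)

/-- For a given interference power and second-hop gain the success event is a tail event of the
first-hop gain, and it is null when the second hop alone is too weak. -/
lemma erlang_slice (n : ℕ) {ρ₁ ρ₂ t u x : ℝ} (hρ₁ : 0 < ρ₁) (hρ₂ : 0 < ρ₂) (ht : 0 < t)
    (hu : 0 ≤ u) (hx : 0 ≤ x) :
    erlang n ((fun α => (α, u, x)) ⁻¹' successSet ρ₁ ρ₂ t) = (Set.Ioi (t / ρ₂)).indicator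
      (fun x => erlang n (Set.Ici (t / ρ₁ * (u + 1) * (x + 1 / ρ₂) / (x - t / ρ₂)))) x := by
  by_cases h : x ∈ Set.Ioi (t / ρ₂)
  · rw [Set.indicator_of_mem h]
    congr 1
    ext α
    have h1 : 0 < x - t / ρ₂ := sub_pos.2 h
    have h2 : ρ₂ * x - t = ρ₂ * (x - t / ρ₂) := by field_simp
    simp only [Set.mem_preimage, successSet, Set.mem_ofPred_eq, Set.mem_Ici]
    rw [div_le_iff₀ h1, h2]
    have h3 : t * (u + 1) * (ρ₂ * x + 1) =
        ρ₁ * ρ₂ * (t / ρ₁ * (u + 1) * (x + 1 / ρ₂)) := by field_simp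
    have h4 : α * ρ₁ * (ρ₂ * (x - t / ρ₂)) = ρ₁ * ρ₂ * (α * (x - t / ρ₂)) := by ring
    rw [h3, h4, mul_le_mul_iff_right₀ (mul_pos hρ₁ hρ₂)]
  · rw [Set.indicator_of_notMem h]
    refine measure_mono_null (t := {α | ¬ 0 ≤ α}) (fun α hα h0 => ?_) (erlang_nonneg n)
    have h1 : ρ₂ * x - t ≤ 0 := by
      have := (le_div_iff₀ hρ₂).1 (not_lt.1 h)
      linarith
    have h2 : 0 < t * (u + 1) * (ρ₂ * x + 1) := by positivity
    have h3 : α * ρ₁ * (ρ₂ * x - t) ≤ 0 :=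
      mul_nonpos_of_nonneg_of_nonpos (mul_nonneg h0 hρ₁.le) h1
    exact absurd (h2.trans_le hα) (not_lt.2 h3)

/-- The success probability as an average over the interference power. -/
lemma measure_successSet (n : ℕ) {ρ₁ ρ₂ t : ℝ} (hρ₁ : 0 < ρ₁) (hρ₂ : 0 < ρ₂) (ht : 0 < t)
    {ρI : Fin M → ℝ} (hρI : ∀ i, 0 < ρI i) :
    ((erlang n).prod ((interferenceLaw ρI).prod (erlang n))).real (successSet ρ₁ ρ₂ t) =
      ∫ u, condSuccess n (t / ρ₁) (t / ρ₂) (1 / ρ₂) u ∂(interferenceLaw ρI) := by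
  have hT := measurableSet_successSet ρ₁ ρ₂ t
  have hA := div_pos ht hρ₁
  have hτ := div_pos ht hρ₂
  have hb := one_div_pos.2 hρ₂
  rw [Measure.real, Measure.prod_apply_symm hT,
    lintegral_prod _ (measurable_measure_prodMk_right hT).aemeasurable,
    integral_eq_lintegral_of_nonneg_ae
      (.of_forall fun u => condSuccess_nonneg n hA.le hτ.le hb.le u)]
  · congr 1
    refine lintegral_congr_ae ((interferenceLaw_nonneg hρI).mono fun u hu => ?_)
    simp only
    rw [← lintegral_erlang_tail n hA hτ hb hu]
    exact lintegral_congr_ae ((erlang_nonneg n).mono fun x hx =>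
      erlang_slice n hρ₁ hρ₂ ht hu hx)
  · have := measurable_condTerm (t / ρ₁) (t / ρ₁ * (t / ρ₂ + 1 / ρ₂))
    unfold condSuccess
    fun_prop

/-- The outage probability through the averaged conditional success probability. -/
lemma outageProb_eq {Ω : Type*} [MeasurableSpace Ω] {μ : Measure Ω} (n : ℕ)
    {Ps Pr N₀ : ℝ} (hPs : 0 < Ps) (hPr : 0 < Pr) (hN₀ : 0 < N₀)
    {PI : Fin M → ℝ} (hPI : ∀ i, 0 < PI i)
    {h₁ : Ω → Fin (n + 1) → ℂ} {hI : Ω → Fin M → Fin (n + 1) → ℂ} {h₂ : Ω → Fin (n + 1) → ℂ}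
    (hlaw : ∀ s, HasLaw (channelEntries h₁ hI h₂ s) stdComplexGaussian μ)
    (hindep : iIndepFun (channelEntries h₁ hI h₂) μ) {t : ℝ} (ht : 0 < t) :
    outageProb μ (fun ω => sinrMRC Ps Pr N₀ PI (h₁ ω) (hI ω) (h₂ ω)) t =
      1 - ∫ u, condSuccess n (t / (Ps / N₀)) (t / (Pr / N₀)) (1 / (Pr / N₀)) u
        ∂(interferenceLaw fun i => PI i / N₀) := by
  have : IsProbabilityMeasure μ := hindep.isProbabilityMeasure
  have hρ₁ := div_pos hPs hN₀
  have hρ₂ := div_pos hPr hN₀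
  have hρI := fun i => div_pos (hPI i) hN₀
  obtain ⟨hm, hmap⟩ := map_channels hlaw hindep
  have hmp := measurePreserving_gains n fun i => PI i / N₀
  let Y : Ω → ℝ × ℝ × ℝ := fun ω => gains (fun i => PI i / N₀) (h₁ ω, hI ω, h₂ ω)
  have hYm : AEMeasurable Y μ := hmp.measurable.comp_aemeasurable hm
  have hYmap : μ.map Y =
      (erlang n).prod ((interferenceLaw fun i => PI i / N₀).prod (erlang n)) := by
    rw [← hmp.map_eq, ← hmap, AEMeasurable.map_map_of_aemeasurable hmp.measurable.aemeasurable hm]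
    rfl
  have hpos : ∀ᵐ ω ∂μ, 0 < sqNorm (h₁ ω) := by
    have h1 : ∀ᵐ p ∂(μ.map Y), 0 < p.1 := by
      rw [hYmap]
      exact Measure.quasiMeasurePreserving_fst.ae (erlang_pos n)
    exact ae_of_ae_map hYm h1
  have hae : {ω | sinrMRC Ps Pr N₀ PI (h₁ ω) (hI ω) (h₂ ω) < t} =ᵐ[μ]
      Y ⁻¹' (successSet (Ps / N₀) (Pr / N₀) t)ᶜ := by
    refine Filter.eventuallyEq_set.2 (hpos.mono fun ω hω => ?_)
    rw [Set.mem_preimage, Set.mem_compl_iff, Set.mem_ofPred_eq, ← not_le, not_iff_not,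
      sinrMRC_eq hPs hPr hN₀ hPI (hI ω) (h₂ ω) hω,
      le_sinr_iff hρ₁ hρ₂ hω.le (combinedInterference_nonneg hρI _ _) (sqNorm_nonneg _)]
    rfl
  have hT := measurableSet_successSet (Ps / N₀) (Pr / N₀) t
  have : IsProbabilityMeasure (μ.map Y) := Measure.isProbabilityMeasure_map hYm
  rw [outageProb, measureReal_congr hae, Measure.real,
    ← Measure.map_apply_of_aemeasurable hYm hT.compl, ← Measure.real, probReal_compl_eq_one_sub hT,
    hYmap, measure_successSet n hρ₁ hρ₂ ht hρI]

end Link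

end Relay

end

theorem theorem1 {Ω : Type*} [MeasurableSpace Ω] (μ : Measure Ω) [IsProbabilityMeasure μ]
    (N M : ℕ) (hN : 1 ≤ N) (hM : 1 ≤ M)
    (Ps Pr N₀ : ℝ) (hPs : 0 < Ps) (hPr : 0 < Pr) (hN₀ : 0 < N₀)
    (PI : Fin M → ℝ) (hPI : ∀ i, 0 < PI i)
    (h₁ : Ω → Fin N → ℂ) (hI : Ω → Fin M → Fin N → ℂ) (h₂ : Ω → Fin N → ℂ)
    (hlaw : ∀ s, HasLaw (Relay.channelEntries h₁ hI h₂ s) Relay.stdComplexGaussian μ)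
    (hindep : iIndepFun (Relay.channelEntries h₁ hI h₂) μ)
    (ρ₁ ρ₂ : ℝ) (ρI : Fin M → ℝ)
    (hρ₁ : ρ₁ = Ps / N₀) (hρ₂ : ρ₂ = Pr / N₀) (hρI : ∀ i, ρI i = PI i / N₀)
    (γth : ℝ) (hγ : 0 < γth) :
    -- the characteristic coefficients of `diag(ρI)` exist and are unique
    (∃! χ, Relay.IsCharCoeff ρI χ) ∧
    -- all integrals in the formula converge
    (∀ m ∈ Finset.range N, ∀ j ∈ Finset.range (m + 1), ∀ k ∈ Finset.range (N + j),
      ∀ p, ∀ q : Fin (Relay.multiplicity ρI p),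
        IntegrableOn
          (Relay.outageIntegrand ρ₁ ρ₂ γth (Relay.distinctVal ρI p) k m q.val)
          (Set.Ioi (0 : ℝ))) ∧
    -- the exact outage probability
    Relay.outageProb μ (fun ω => Relay.sinrMRC Ps Pr N₀ PI (h₁ ω) (hI ω) (h₂ ω)) γth =
      1 - 2 * Real.exp (-(γth / ρ₁) - γth / ρ₂) / Real.Gamma N *
        ∑ m ∈ Finset.range N, (γth / ρ₁) ^ m * (1 / (m ! : ℝ)) *
          ∑ j ∈ Finset.range (m + 1), (m.choose j : ℝ) * (1 / ρ₂) ^ (m - j) *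
            ∑ k ∈ Finset.range (N + j), ((N + j - 1).choose k : ℝ) *
              (γth / ρ₂) ^ (N + j - 1 - k) *
              ((γth + 1) * γth / (ρ₁ * ρ₂)) ^ (((k : ℝ) - m + 1) / 2) *
              Relay.outageIntegral ρ₁ ρ₂ ρI γth k m := by
  have hρI' : ρI = fun i => PI i / N₀ := funext hρI
  have hρIpos : ∀ i, 0 < ρI i := fun i => hρI i ▸ div_pos (hPI i) hN₀
  have hρ₁pos : 0 < ρ₁ := hρ₁ ▸ div_pos hPs hN₀
  have hρ₂pos : 0 < ρ₂ := hρ₂ ▸ div_pos hPr hN₀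
  refine ⟨Relay.existsUnique_isCharCoeff hM hρIpos, fun m _ j _ k _ p q =>
    Relay.integrableOn_outageIntegrand hρ₁pos hρ₂pos hγ (Relay.distinctVal_pos hρIpos p) k m _, ?_⟩
  obtain ⟨n, rfl⟩ := Nat.exists_eq_add_of_le' hN
  rw [Relay.outageProb_eq n hPs hPr hN₀ hPI hlaw hindep hγ, ← hρI', ← hρ₁, ← hρ₂]
  have hA := div_pos hγ hρ₁pos
  have hτ := div_pos hγ hρ₂pos
  have hb := one_div_pos.2 hρ₂pos
  have hi (k m : ℕ) := Relay.integrable_condTerm hA hτ hb (ν := Relay.interferenceLaw ρI) k m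
  have hc : γth / ρ₁ * (γth / ρ₂ + 1 / ρ₂) = (γth + 1) * γth / (ρ₁ * ρ₂) := by
    field_simp
  have hn (j : ℕ) : n + 1 + j - 1 = n + j := by omega
  have hn' (j : ℕ) : n + 1 + j = n + j + 1 := by omega
  unfold Relay.condSuccess
  rw [integral_const_mul, integral_finsetSum _ fun m _ =>
    (integrable_finsetSum _ fun j _ => (integrable_finsetSum _ fun k _ =>
      (hi k m).const_mul _).const_mul _).const_mul _, Nat.cast_add_one,
    Real.Gamma_nat_eq_factorial, mul_div_assoc (2 : ℝ), mul_comm (2 : ℝ), mul_assoc,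
    Finset.mul_sum _ _ (2 : ℝ)]
  congr 2
  refine Finset.sum_congr rfl fun m _ => ?_
  rw [integral_const_mul, integral_finsetSum _ fun j _ => (integrable_finsetSum _ fun k _ =>
    (hi k m).const_mul _).const_mul _, mul_left_comm (2 : ℝ), Finset.mul_sum _ _ (2 : ℝ)]
  congr 1
  refine Finset.sum_congr rfl fun j _ => ?_
  rw [integral_const_mul, integral_finsetSum _ fun k _ => (hi k m).const_mul _,
    mul_left_comm (2 : ℝ), Finset.mul_sum _ _ (2 : ℝ), hn, hn']
  congr 1
  refine Finset.sum_congr rfl fun k _ => ?_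
  rw [integral_const_mul, hc, Relay.integral_condTerm hM hρ₁pos hρ₂pos hγ hρIpos]
  ring
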